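/- Let $G$ be a (real, finite-dimensional) Lie group, $K\subset G$ a compact subgroup, and $G_r\subset G$ an open subset with $KG_rK=G_r$. Assume that $(G_r,K)$ has a well-behaved $KAK$ decomposition, i.e. there are a submanifold $A_r$ of $G$ and a subgroup $M$ of $K$ such that: - for every $g\in G_r$ there is a unique $a(g)\in A_r$ with $g\in K\,a(g)\,K$, and the map $a:G_r\to A_r$ is smooth; - for every $a\in A_r$, $\{(k_1,k_2)\in K\times K : k_1ak_2^{-1}=a\}=\{(k,k): k\in M\}$; - every $x\in G_r$ has an open neighbourhood $O_x\subset G_r$ with smooth maps $k_1,k_2:O_x\to K$ such that $g=k_1(g)\,a(g)\,k_2(g)^{-1}$ for all $g\in O_x$. A matrix coefficient is a function $g\mapsto\langle\pi(g)\xi,\eta\rangle$ with $\pi$ a strongly continuous unitary representation of $G$ on a complex Hilbert space $\mathcal H$ and $\xi,\eta\in\mathcal H$. It is $K$-bi-invariant if it is invariant under left and right translations by $K$, and $K$-finite if $\operatorname{span}\pi(K)\xi$ and $\operatorname{span}\pi(K)\eta$ are finite-dimensional. For $r\in\mathbb N$ and $\delta\in[0,1]$, a function $f:G\to\mathbb C$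 is in $C^{(r,\delta)}(G_r)$ if for every smooth chart $\varphi:V\to\varphi(V)\subset\mathbb R^n$ with $V\subset G_r$ open, $f\circ\varphi^{-1}$ is of class $C^r$ and, if $\delta>0$, its $r$-th differential is $\delta$-Hölder on each compact subset of $\varphi(V)$. Then for all $r\in\mathbb N$ and $\delta\in[0,1]$, every $K$-bi-invariant matrix coefficient of a unitary representation of $G$ is in $C^{(r,\delta)}(G_r)$ if and only if every $K$-finite matrix coefficient of a unitary representation of $G$ is in $C^{(r,\delta)}(G_r)$. In particular, the optimal regularity on $G_r$, i.e. the supremum in $[0,\infty]$ of $r+\delta$ over all $(r,\delta)\in\mathbb N\times[0,1]$ for which all coefficients of the class are in $C^{(r,\delta)}(G_r)$, is the same for $K$-bi-invariant and for $K$-finite matrix coefficients. -/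

import Mathlib

open scoped Manifold ContDiff ENNReal

noncomputable section

namespace KAKRegularity

universe u v

/-! ### Hölder spaces -/

/-- `f ∈ C^{(r,α)}(s, F)` for an open subset `s` of a normed space: `f` is of class `C^r` on `s`
and, if `α > 0`, its `r`-th differential is `α`-Hölder on every compact subset of `s`.
For `α = 0` this is `C^r(s, F)`. -/
def IsHolderOn {E F : Type*} [NormedAddCommGroup E] [NormedSpace ℝ E]
    [NormedAddCommGroup F] [NormedSpace ℝ F]
    (r : ℕ) (α : ℝ) (f : E → F) (s : Set E) : Prop :=
  ContDiffOn ℝ r f s ∧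
    (0 < α → ∀ L : Set E, IsCompact L → L ⊆ s → ∃ C : ℝ, ∀ x ∈ L, ∀ y ∈ L,
      ‖iteratedFDeriv ℝ r f x - iteratedFDeriv ℝ r f y‖ ≤ C * ‖x - y‖ ^ α)

/-- `f ∈ C^{(r,α)}(U)` for an open subset `U` of a smooth manifold `X` modelled on `E`:
in every smooth chart `φ` of `X` whose domain lies in `U`, the function `f ∘ φ⁻¹` is in
`C^{(r,α)}` of the image of the chart. -/
def IsHolderOnManifold (E : Type v) [NormedAddCommGroup E] [NormedSpace ℝ E]
    {X : Type u} [TopologicalSpace X] [ChartedSpace E X]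
    (r : ℕ) (α : ℝ) (f : X → ℂ) (U : Set X) : Prop :=
  ∀ φ ∈ IsManifold.maximalAtlas 𝓘(ℝ, E) ∞ X, φ.source ⊆ U →
    IsHolderOn r α (f ∘ φ.symm) φ.target

/-- The exponents `(r, δ) ∈ ℕ × [0, 1]` such that every function of the family `𝓕` is in
`C^{(r,δ)}(U)`. -/
def regularityExponents (E : Type v) [NormedAddCommGroup E] [NormedSpace ℝ E]
    {X : Type u} [TopologicalSpace X] [ChartedSpace E X]
    (𝓕 : Set (X → ℂ)) (U : Set X) : Set (ℕ × ℝ) :=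
  {p | 0 ≤ p.2 ∧ p.2 ≤ 1 ∧ ∀ f ∈ 𝓕, IsHolderOnManifold E p.1 p.2 f U}

/-- The optimal regularity on `U` of the family `𝓕`: the supremum in `[0, ∞]` of `r + δ` over all
`(r, δ) ∈ ℕ × [0, 1]` such that every function of the family is in `C^{(r,δ)}(U)`. -/
def optimalRegularity (E : Type v) [NormedAddCommGroup E] [NormedSpace ℝ E]
    {X : Type u} [TopologicalSpace X] [ChartedSpace E X]
    (𝓕 : Set (X → ℂ)) (U : Set X) : ℝ≥0∞ :=
  ⨆ p ∈ regularityExponents E 𝓕 U, ((p.1 : ℝ≥0∞) + ENNReal.ofReal p.2)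

/-! ### Unitary representations and their matrix coefficients -/

/-- A (strongly continuous) unitary representation of `G` on `𝓗`. -/
structure UnitaryRep (G : Type u) [Group G] [TopologicalSpace G]
    (𝓗 : Type u) [NormedAddCommGroup 𝓗] [InnerProductSpace ℂ 𝓗] where
  toHom : G →* (𝓗 ≃ₗᵢ[ℂ] 𝓗)
  continuous_orbit : ∀ ξ : 𝓗, Continuous fun g : G => toHom g ξ

section Coefficients

variable {G : Type u} [Group G] [TopologicalSpace G]

/-- The matrix coefficient `g ↦ ⟨π(g) ξ, η⟩`, the inner product being linear in its first slot
(Mathlib's `inner` is linear in its second slot). -/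
def UnitaryRep.coeff {𝓗 : Type u} [NormedAddCommGroup 𝓗] [InnerProductSpace ℂ 𝓗]
    (π : UnitaryRep G 𝓗) (ξ η : 𝓗) : G → ℂ :=
  fun g => inner ℂ η (π.toHom g ξ)

/-- `ξ` is `K`-finite: the span of `π(K) ξ` is finite-dimensional. -/
def UnitaryRep.IsKFinite {𝓗 : Type u} [NormedAddCommGroup 𝓗] [InnerProductSpace ℂ 𝓗]
    (π : UnitaryRep G 𝓗) (K : Subgroup G) (ξ : 𝓗) : Prop :=
  FiniteDimensional ℂ (Submodule.span ℂ ((fun k : G => π.toHom k ξ) '' (K : Set G)))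

/-- The matrix coefficients of unitary representations of `G` on Hilbert spaces that are
`K`-bi-invariant functions. Hilbert spaces in the universe of `G` suffice: a coefficient only sees
the cyclic subrepresentation generated by one vector, which has a copy in that universe. -/
def biInvariantCoefficients (K : Subgroup G) : Set (G → ℂ) :=
  {φ | (∃ (𝓗 : Type u) (_ : NormedAddCommGroup 𝓗) (_ : InnerProductSpace ℂ 𝓗)
      (_ : CompleteSpace 𝓗) (π : UnitaryRep G 𝓗) (ξ η : 𝓗), φ = π.coeff ξ η) ∧
    ∀ k₁ ∈ K, ∀ k₂ ∈ K, ∀ g : G, φ (k₁ * g * k₂) = φ g}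

/-- The `K`-finite matrix coefficients of unitary representations of `G` on Hilbert spaces:
those associated with two `K`-finite vectors. -/
def kFiniteCoefficients (K : Subgroup G) : Set (G → ℂ) :=
  {φ | ∃ (𝓗 : Type u) (_ : NormedAddCommGroup 𝓗) (_ : InnerProductSpace ℂ 𝓗)
      (_ : CompleteSpace 𝓗) (π : UnitaryRep G 𝓗) (ξ η : 𝓗),
      π.IsKFinite K ξ ∧ π.IsKFinite K η ∧ φ = π.coeff ξ η}

end Coefficients

/-! ### Well-behaved `KAK` decompositions -/

/-- `A` is an (embedded) submanifold of `X`: around each of its points there is a smooth chart of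
`X` in which `A` is a linear subspace. -/
def IsSubmanifold (E : Type v) [NormedAddCommGroup E] [NormedSpace ℝ E]
    {X : Type u} [TopologicalSpace X] [ChartedSpace E X] (A : Set X) : Prop :=
  ∀ x ∈ A, ∃ φ ∈ IsManifold.maximalAtlas 𝓘(ℝ, E) ∞ X, x ∈ φ.source ∧
    ∃ F : Submodule ℝ E, φ.IsImage A (F : Set E)

/-- `(Gr, K)` has a well-behaved `KAK` decomposition. Smoothness of maps into the embedded
submanifold `A` and into the compact (hence closed, hence embedded) subgroup `K` is smoothness as
maps into `G`. -/
def HasWellBehavedKAK (E : Type v) [NormedAddCommGroup E] [NormedSpace ℝ E]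
    {G : Type u} [Group G] [TopologicalSpace G] [ChartedSpace E G]
    (Gr : Set G) (K : Subgroup G) : Prop :=
  ∃ (A : Set G) (M : Subgroup G) (a : G → G),
    IsSubmanifold E A ∧ M ≤ K ∧
    -- `a g` is the unique point of `A` with `g ∈ K (a g) K`
    (∀ g ∈ Gr, a g ∈ A ∧ (∃ k₁ ∈ K, ∃ k₂ ∈ K, g = k₁ * a g * k₂) ∧
      ∀ b ∈ A, (∃ k₁ ∈ K, ∃ k₂ ∈ K, g = k₁ * b * k₂) → b = a g) ∧
    ContMDiffOn 𝓘(ℝ, E) 𝓘(ℝ, E) ∞ a Gr ∧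
    -- the stabilizer of each point of `A` in `K × K` is the diagonal of `M`
    (∀ b ∈ A, {p : G × G | p.1 ∈ K ∧ p.2 ∈ K ∧ p.1 * b * p.2⁻¹ = b} =
      {p : G × G | p.1 = p.2 ∧ p.1 ∈ M}) ∧
    -- locally, the `K`-components can be chosen smoothly
    (∀ x ∈ Gr, ∃ O : Set G, IsOpen O ∧ x ∈ O ∧ O ⊆ Gr ∧ ∃ k₁ k₂ : G → G,
      ContMDiffOn 𝓘(ℝ, E) 𝓘(ℝ, E) ∞ k₁ O ∧ ContMDiffOn 𝓘(ℝ, E) 𝓘(ℝ, E) ∞ k₂ O ∧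
      ∀ g ∈ O, k₁ g ∈ K ∧ k₂ g ∈ K ∧ g = k₁ g * a g * (k₂ g)⁻¹)

end KAKRegularity

end

/-! A K-bi-invariant coefficient is unchanged when both vectors are averaged over K, so it is
K-finite (`biInvariantCoefficients_subset_kFiniteCoefficients`). The content is the converse
transfer of regularity, `isHolderOnManifold_of_mem_kFiniteCoefficients`.

Let V and W be the spans of the K-orbits of ξ and η, and let F(b) be the compression of π(b) to an
operator V → W. For b in A, the group M centralizes b, so F(b) lies in the finite-dimensional space
Hom_M(V, W). Writing g = k₁ a(g) k₂⁻¹, the coefficient at g is ⟨F(a(g)) π(k₂⁻¹)ξ, π(k₁⁻¹)η⟩, so it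
is enough to express F ∘ a locally through bi-invariant coefficients with smooth weights.

Compactly supported K-equivariant fields v : G → V and w : G → W give the bi-invariant coefficient
ψ(g) = ∫ ⟨π(g) v(g⁻¹y), w(y)⟩ dy (`integral_inner_mem_biInvariantCoefficients`). It satisfies ψ(b) =
d_b(F(b)), where d_g(T) = ∫ ⟨T v(g⁻¹y), w(y)⟩ dy is smooth in g when v is. The stabilizer hypothesis
makes these functionals separate the points of Hom_M(V, W) at each b in A
(`exists_field_integral_inner_ne_zero`). Finitely many of them then recover T smoothly near b
(`exists_contMDiffAt_reconstruction`). Since ψ(a(g)) = ψ(g), the coefficient is locally ∑ ψᵢ sᵢ with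
smooth sᵢ, and `IsHolderOnManifold.of_locally_sum_mul` concludes. -/

noncomputable section

namespace KAKRegularity

open scoped Topology Pointwise
open Filter Set MeasureTheory

universe u v

/-! ### Pointwise Hölder calculus on normed spaces. -/

section Holder

variable {E F F' : Type*} [NormedAddCommGroup E] [NormedAddCommGroup F] [NormedAddCommGroup F']

/-- `f` is `α`-Hölder in a neighbourhood of `x`. -/
def LocHolderAt {E F : Type*} [NormedAddCommGroup E] [NormedAddCommGroup F]
    (α : ℝ) (f : E → F) (x : E) : Prop :=
  ∃ C : ℝ, ∀ᶠ p in 𝓝 (x, x), ‖f p.1 - f p.2‖ ≤ C * ‖p.1 - p.2‖ ^ α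

theorem LocHolderAt.congr {α : ℝ} {f g : E → F} {x : E} (hf : LocHolderAt α f x)
    (h : f =ᶠ[𝓝 x] g) : LocHolderAt α g x := by
  obtain ⟨C, hC⟩ := hf
  refine ⟨C, ?_⟩
  rw [nhds_prod_eq] at hC ⊢
  filter_upwards [hC, tendsto_fst.eventually h, tendsto_snd.eventually h] with p hp h1 h2
  rwa [← h1, ← h2]

theorem LocHolderAt.add {α : ℝ} {f g : E → F} {x : E} (hf : LocHolderAt α f x)
    (hg : LocHolderAt α g x) : LocHolderAt α (f + g) x := by
  obtain ⟨C, hC⟩ := hf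
  obtain ⟨D, hD⟩ := hg
  refine ⟨C + D, ?_⟩
  filter_upwards [hC, hD] with p hp hq
  calc ‖(f + g) p.1 - (f + g) p.2‖ = ‖(f p.1 - f p.2) + (g p.1 - g p.2)‖ := by
        simp only [Pi.add_apply]; congr 1; abel
    _ ≤ _ := norm_add_le _ _
    _ ≤ _ := by rw [add_mul]; exact add_le_add hp hq

variable [NormedSpace ℝ F] [NormedSpace ℝ F']

theorem LocHolderAt.clm_comp {α : ℝ} {f : E → F} {x : E} (hf : LocHolderAt α f x)
    (L : F →L[ℝ] F') : LocHolderAt α (fun y => L (f y)) x := by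
  obtain ⟨C, hC⟩ := hf
  refine ⟨‖L‖ * C, ?_⟩
  filter_upwards [hC] with p hp
  rw [← map_sub, mul_assoc]
  exact (L.le_opNorm _).trans (by gcongr)

variable [NormedSpace ℝ E]

theorem LocHolderAt.of_contDiffAt {α : ℝ} (hα : α ≤ 1) {f : E → F} {x : E}
    (hf : ContDiffAt ℝ 1 f x) : LocHolderAt α f x := by
  obtain ⟨K, t, ht, hK⟩ := hf.exists_lipschitzOnWith
  refine ⟨K, ?_⟩
  -- At distance t < 1 one has t ≤ t ^ α because α ≤ 1, so a Lipschitz bound is a Hölder bound.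
  have h1 : ∀ᶠ p : E × E in 𝓝 (x, x), ‖p.1 - p.2‖ < 1 := by
    have : ContinuousAt (fun p : E × E => ‖p.1 - p.2‖) (x, x) := by fun_prop
    refine this.eventually_lt continuousAt_const ?_
    simp
  filter_upwards [h1, prod_mem_nhds ht ht] with p hp hpt
  have h2 := hK.norm_sub_le hpt.1 hpt.2
  refine h2.trans ?_
  gcongr
  rcases (norm_nonneg (p.1 - p.2)).eq_or_lt with h0 | h0
  · rw [← h0]; exact Real.rpow_nonneg le_rfl _
  · calc ‖p.1 - p.2‖ = ‖p.1 - p.2‖ ^ (1 : ℝ) := (Real.rpow_one _).symm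
      _ ≤ _ := Real.rpow_le_rpow_of_exponent_ge h0 hp.le hα

/-- `f` is of class `C^{(r,α)}` in a neighbourhood of `x`. -/
def HolderAt (r : ℕ) (α : ℝ) (f : E → F) (x : E) : Prop :=
  ContDiffAt ℝ r f x ∧ (0 < α → LocHolderAt α (iteratedFDeriv ℝ r f) x)

/-- Compactness of L × L reduces a uniform constant to local ones: near the diagonal this is the
local Hölder bound, and away from it ‖x - y‖ ^ α stays bounded below. Working pointwise makes
congruence, sums and products easy. -/
theorem isHolderOn_iff_holderAt [FiniteDimensional ℝ E] {r : ℕ} {α : ℝ} {f : E → F} {s : Set E}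
    (hs : IsOpen s) : IsHolderOn r α f s ↔ ∀ x ∈ s, HolderAt r α f x := by
  have : ProperSpace E := FiniteDimensional.proper ℝ E
  constructor
  · rintro ⟨h1, h2⟩ x hx
    refine ⟨h1.contDiffAt (hs.mem_nhds hx), fun hα => ?_⟩
    obtain ⟨ε, hε, hb⟩ := Metric.nhds_basis_closedBall.mem_iff.1 (hs.mem_nhds hx)
    obtain ⟨C, hC⟩ := h2 hα _ (isCompact_closedBall x ε) hb
    refine ⟨C, ?_⟩
    have := Metric.closedBall_mem_nhds x hε
    filter_upwards [prod_mem_nhds this this] with p hp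
    exact hC _ hp.1 _ hp.2
  · intro h
    have hc : ContDiffOn ℝ r f s := fun x hx => (h x hx).1.contDiffWithinAt
    refine ⟨hc, fun hα L hL hLs => ?_⟩
    set D := iteratedFDeriv ℝ r f
    have hDc : ∀ x ∈ s, ContinuousAt D x := fun x hx =>
      ((h x hx).1.iteratedFDeriv_right (m := 0) (i := r) (by simp)).continuousAt
    have key : ∃ C : ℝ, ∀ p ∈ L ×ˢ L, ‖D p.1 - D p.2‖ ≤ C * ‖p.1 - p.2‖ ^ α := by
      refine (hL.prod hL).induction_on (p := fun t => ∃ C : ℝ, ∀ p ∈ t,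
        ‖D p.1 - D p.2‖ ≤ C * ‖p.1 - p.2‖ ^ α) ⟨0, by simp⟩ ?_ ?_ ?_
      · rintro t t' htt' ⟨C, hC⟩
        exact ⟨C, fun p hp => hC p (htt' hp)⟩
      · rintro t t' ⟨C, hC⟩ ⟨C', hC'⟩
        refine ⟨max C C', ?_⟩
        rintro p (hp | hp)
        · exact (hC p hp).trans (by gcongr; exact le_max_left _ _)
        · exact (hC' p hp).trans (by gcongr; exact le_max_right _ _)
      · rintro ⟨x, y⟩ ⟨hx, hy⟩
        rcases eq_or_ne x y with rfl | hxy
        · obtain ⟨C, hC⟩ := (h x (hLs hx)).2 hα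
          exact ⟨_, mem_nhdsWithin_of_mem_nhds hC, C, fun p hp => hp⟩
        -- The constant is chosen so that this continuous function equals -1 at (x, y); it stays
        -- negative nearby.
        · have hc1 : ContinuousAt (fun p : E × E => ‖D p.1 - D p.2‖ -
              ((‖D x - D y‖ + 1) / ‖x - y‖ ^ α) * ‖p.1 - p.2‖ ^ α) (x, y) := by
            have e1 : ContinuousAt (fun p : E × E => D p.1) (x, y) :=
              ContinuousAt.comp (f := Prod.fst) (g := D) (hDc x (hLs hx)) continuousAt_fst
            have e2 : ContinuousAt (fun p : E × E => D p.2) (x, y) :=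
              ContinuousAt.comp (f := Prod.snd) (g := D) (hDc y (hLs hy)) continuousAt_snd
            have e3 : ContinuousAt (fun p : E × E => ‖p.1 - p.2‖ ^ α) (x, y) :=
              ContinuousAt.rpow_const (by fun_prop) (Or.inr hα.le)
            exact (e1.sub e2).norm.sub (continuousAt_const.mul e3)
          have hpos : 0 < ‖x - y‖ ^ α := Real.rpow_pos_of_pos (norm_pos_iff.2 (sub_ne_zero.2 hxy)) _
          have hlt := hc1.eventually_lt (continuousAt_const (y := (0 : ℝ))) (by
            dsimp only
            rw [div_mul_cancel₀ _ hpos.ne']; linarith)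
          exact ⟨_, mem_nhdsWithin_of_mem_nhds hlt, _, fun p hp => (sub_neg.1 hp).le⟩
    obtain ⟨C, hC⟩ := key
    exact ⟨C, fun x hx y hy => hC (x, y) ⟨hx, hy⟩⟩

theorem HolderAt.congr {r : ℕ} {α : ℝ} {f g : E → F} {x : E} (hf : HolderAt r α f x)
    (h : f =ᶠ[𝓝 x] g) : HolderAt r α g x :=
  ⟨hf.1.congr_of_eventuallyEq h.symm, fun hα => (hf.2 hα).congr (h.iteratedFDeriv ℝ r)⟩

theorem HolderAt.of_contDiffAt {r : ℕ} {α : ℝ} (hα : α ≤ 1) {f : E → F} {x : E}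
    (hf : ContDiffAt ℝ (r + 1 : ℕ) f x) : HolderAt r α f x :=
  ⟨hf.of_le (by exact_mod_cast Nat.le_succ r), fun _ =>
    .of_contDiffAt hα (hf.iteratedFDeriv_right (m := 1) (i := r)
      (by push_cast; rw [add_comm]))⟩

theorem HolderAt.add {r : ℕ} {α : ℝ} {f g : E → F} {x : E} (hf : HolderAt r α f x)
    (hg : HolderAt r α g x) : HolderAt r α (f + g) x := by
  refine ⟨hf.1.add hg.1, fun hα => ((hf.2 hα).add (hg.2 hα)).congr ?_⟩
  filter_upwards [hf.1.eventually (by simp), hg.1.eventually (by simp)] with y hy hy'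
  rw [Pi.add_apply, iteratedFDeriv_add_apply hy hy']

theorem HolderAt.clm_comp {r : ℕ} {α : ℝ} {f : E → F} {x : E} (hf : HolderAt r α f x)
    (L : F →L[ℝ] F') : HolderAt r α (fun y => L (f y)) x := by
  refine ⟨L.contDiff.contDiffAt.comp x hf.1, fun hα => ?_⟩
  have h1 := (hf.2 hα).clm_comp (ContinuousLinearMap.compContinuousMultilinearMapL ℝ
    (fun _ : Fin r => E) F F' L)
  refine h1.congr ?_
  filter_upwards [hf.1.eventually (by simp)] with y hy
  exact (L.iteratedFDeriv_comp_left hy (i := r) le_rfl).symm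

theorem HolderAt.sum {ι : Type*} (s : Finset ι) {r : ℕ} {α : ℝ} {f : ι → E → F} {x : E}
    (hα : α ≤ 1) (hf : ∀ i ∈ s, HolderAt r α (f i) x) :
    HolderAt r α (fun y => ∑ i ∈ s, f i y) x := by
  classical
  induction s using Finset.induction_on with
  | empty => simpa using HolderAt.of_contDiffAt hα contDiffAt_const
  | insert i s hi ih =>
    simp only [Finset.sum_insert hi]
    exact (hf i (by simp)).add (ih fun j hj => hf j (by simp [hj]))

/-- The (r+1)-st iterated derivative is the r-th one of `fderiv ℝ f` up to a linear isometry, which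
preserves Hölder bounds. This drives the induction for products. -/
theorem holderAt_succ_iff {r : ℕ} {α : ℝ} {f : E → F} {x : E} :
    HolderAt (r + 1) α f x ↔ ContDiffAt ℝ (r + 1 : ℕ) f x ∧ HolderAt r α (fderiv ℝ f) x := by
  have hiff : LocHolderAt α (iteratedFDeriv ℝ (r + 1) f) x ↔
      LocHolderAt α (iteratedFDeriv ℝ r (fderiv ℝ f)) x := by
    simp only [LocHolderAt, iteratedFDeriv_succ_eq_comp_right, Function.comp_apply]
    refine exists_congr fun C => eventually_congr (.of_forall fun p => ?_)
    rw [← LinearIsometryEquiv.map_sub, LinearIsometryEquiv.norm_map]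
  simp only [HolderAt, hiff]
  constructor
  · rintro ⟨h1, h2⟩
    exact ⟨h1, h1.fderiv_right (by push_cast; rfl), h2⟩
  · rintro ⟨h1, _, h2⟩
    exact ⟨h1, h2⟩

theorem HolderAt.mul [FiniteDimensional ℝ E] {r : ℕ} {α : ℝ} (hα : α ≤ 1) {f g : E → ℂ} {x : E}
    (hf : HolderAt r α f x) (hg : HolderAt r α g x) : HolderAt r α (fun y => f y * g y) x := by
  induction r generalizing f g with
  | zero =>
    refine ⟨hf.1.mul hg.1, fun h0 => ?_⟩
    have conv : ∀ h : E → ℂ, LocHolderAt α (iteratedFDeriv ℝ 0 h) x ↔ LocHolderAt α h x := by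
      intro h
      simp only [LocHolderAt, iteratedFDeriv_zero_eq_comp, Function.comp_apply]
      refine exists_congr fun C => eventually_congr (.of_forall fun p => ?_)
      rw [← map_sub, LinearIsometryEquiv.norm_map]
    rw [conv]
    obtain ⟨C, hC⟩ := (conv f).1 (hf.2 h0)
    obtain ⟨D, hD⟩ := (conv g).1 (hg.2 h0)
    refine ⟨(‖f x‖ + 1) * D + (‖g x‖ + 1) * C, ?_⟩
    have b1 : ∀ᶠ p : E × E in 𝓝 (x, x), ‖f p.1‖ < ‖f x‖ + 1 :=
      (ContinuousAt.comp (f := Prod.fst) (g := f) (x := (x, x)) hf.1.continuousAt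
        continuousAt_fst).norm.eventually_lt continuousAt_const (by simp)
    have b2 : ∀ᶠ p : E × E in 𝓝 (x, x), ‖g p.2‖ < ‖g x‖ + 1 :=
      (ContinuousAt.comp (f := Prod.snd) (g := g) (x := (x, x)) hg.1.continuousAt
        continuousAt_snd).norm.eventually_lt continuousAt_const (by simp)
    filter_upwards [hC, hD, b1, b2] with p hp hq h1 h2
    calc ‖f p.1 * g p.1 - f p.2 * g p.2‖
        = ‖f p.1 * (g p.1 - g p.2) + g p.2 * (f p.1 - f p.2)‖ := by ring_nf
      _ ≤ ‖f p.1‖ * ‖g p.1 - g p.2‖ + ‖g p.2‖ * ‖f p.1 - f p.2‖ := by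
        refine (norm_add_le _ _).trans ?_
        rw [norm_mul, norm_mul]
      _ ≤ (‖f x‖ + 1) * (D * ‖p.1 - p.2‖ ^ α) + (‖g x‖ + 1) * (C * ‖p.1 - p.2‖ ^ α) := by
        gcongr
      _ = _ := by ring
  | succ r ih =>
    have hf' := holderAt_succ_iff.1 hf
    have hg' := holderAt_succ_iff.1 hg
    refine holderAt_succ_iff.2 ⟨hf.1.mul hg.1, ?_⟩
    -- A linear form is rebuilt from its values on a basis, so the Leibniz rule involves only
    -- products of scalar functions and the induction hypothesis applies to them.
    let b := Module.finBasis ℝ E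
    let L : Fin (Module.finrank ℝ E) → ℂ →L[ℝ] (E →L[ℝ] ℂ) := fun i =>
      ContinuousLinearMap.smulRightL ℝ E ℂ (LinearMap.toContinuousLinearMap (b.coord i))
    have hL : ∀ T : E →L[ℝ] ℂ, T = ∑ i, L i (T (b i)) := by
      intro T
      ext v
      conv_lhs => rw [← b.sum_repr v, map_sum]
      simp [L, map_smul]
    have hf0 : HolderAt r α f x := .of_contDiffAt hα hf.1
    have hg0 : HolderAt r α g x := .of_contDiffAt hα hg.1
    have hap : ∀ (h : E → ℂ) (i), HolderAt r α (fderiv ℝ h) x →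
        HolderAt r α (fun y => fderiv ℝ h y (b i)) x := fun h i hh =>
      hh.clm_comp (ContinuousLinearMap.apply ℝ ℂ (b i))
    have hs : HolderAt r α (fun y => ∑ i, L i (f y * fderiv ℝ g y (b i) +
        g y * fderiv ℝ f y (b i))) x := by
      refine HolderAt.sum _ hα fun i _ => HolderAt.clm_comp ?_ (L i)
      exact (ih hf0 (hap g i hg'.2)).add (ih hg0 (hap f i hf'.2))
    refine hs.congr ?_
    filter_upwards [hf.1.eventually (by simp), hg.1.eventually (by simp)] with y hy hy'
    rw [hL (fderiv ℝ (fun y => f y * g y) y)]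
    refine Finset.sum_congr rfl fun i _ => ?_
    rw [fderiv_fun_mul (hy.differentiableAt (by simp)) (hy'.differentiableAt (by simp))]
    simp

end Holder

/-- A function which is locally a combination of functions in `C^{(r,α)}` with smooth coefficients
is in `C^{(r,α)}`. -/
theorem IsHolderOnManifold.of_locally_sum_mul
    {E : Type*} [NormedAddCommGroup E] [NormedSpace ℝ E] [FiniteDimensional ℝ E]
    {X : Type*} [TopologicalSpace X] [ChartedSpace E X] [IsManifold 𝓘(ℝ, E) ∞ X]
    {r : ℕ} {α : ℝ} (hα : α ≤ 1) {f : X → ℂ} {U : Set X}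
    (h : ∀ x ∈ U, ∃ (n : ℕ) (ψ s : Fin n → X → ℂ), (∀ i, IsHolderOnManifold E r α (ψ i) U) ∧
      (∀ i, ContMDiffAt 𝓘(ℝ, E) 𝓘(ℝ, ℂ) ∞ (s i) x) ∧
      f =ᶠ[𝓝 x] fun y => ∑ i, ψ i y * s i y) :
    IsHolderOnManifold E r α f U := by
  intro φ hφ hφU
  rw [isHolderOn_iff_holderAt φ.open_target]
  intro z hz
  obtain ⟨n, ψ, s, hψ, hs, hfe⟩ := h (φ.symm z) (hφU (φ.map_target hz))
  have hcont : ContinuousAt φ.symm z := φ.continuousAt_symm hz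
  have h1 : HolderAt r α (fun y => ∑ i, ψ i (φ.symm y) * s i (φ.symm y)) z := by
    refine HolderAt.sum _ hα fun i _ => HolderAt.mul hα ?_ ?_
    · exact (isHolderOn_iff_holderAt φ.open_target).1 (hψ i φ hφ hφU) z hz
    · refine .of_contDiffAt hα ?_
      have h2 : ContMDiffAt 𝓘(ℝ, E) 𝓘(ℝ, E) ∞ φ.symm z :=
        (contMDiffOn_symm_of_mem_maximalAtlas hφ).contMDiffAt (φ.open_target.mem_nhds hz)
      have h3 := (ContMDiffAt.comp z (hs i) h2).contDiffAt
      exact h3.of_le (by exact_mod_cast le_top)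
  exact h1.congr (Filter.EventuallyEq.symm (hcont.tendsto.eventually hfe))

/-! ### Smooth dependence of integrals on a parameter in a manifold. -/

section ParametricIntegral

variable {E : Type*} [NormedAddCommGroup E] [NormedSpace ℝ E]
  {Y : Type*} [TopologicalSpace Y] [ChartedSpace E Y] [IsManifold 𝓘(ℝ, E) ∞ Y]
  {F₁ F₂ : Type*} [NormedAddCommGroup F₁] [NormedSpace ℝ F₁]
  [NormedAddCommGroup F₂] [NormedSpace ℝ F₂]

/-- The partial derivative of a smooth function in a vector space variable is smooth in all
variables. -/
theorem contMDiffAt_fderiv_fst {Φ : E → Y → F₁} {p : E × Y}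
    (h : ContMDiffAt (𝓘(ℝ, E).prod 𝓘(ℝ, E)) 𝓘(ℝ, F₁) ∞ (Function.uncurry Φ) p) :
    ContMDiffAt (𝓘(ℝ, E).prod 𝓘(ℝ, E)) 𝓘(ℝ, E →L[ℝ] F₁) ∞
      (fun q : E × Y => fderiv ℝ (fun x => Φ x q.2) q.1) p := by
  have h1 : ContMDiffAt ((𝓘(ℝ, E).prod 𝓘(ℝ, E)).prod 𝓘(ℝ, E)) 𝓘(ℝ, F₁) ∞
      (Function.uncurry fun (q : E × Y) (x : E) => Φ x q.2) (p, p.1) := by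
    have h2 : ContMDiffAt ((𝓘(ℝ, E).prod 𝓘(ℝ, E)).prod 𝓘(ℝ, E)) (𝓘(ℝ, E).prod 𝓘(ℝ, E)) ∞
        (fun r : (E × Y) × E => (r.2, r.1.2)) (p, p.1) :=
      contMDiffAt_snd.prodMk (contMDiffAt_snd.comp _ contMDiffAt_fst)
    exact ContMDiffAt.comp (p, p.1) (g := Function.uncurry Φ) h h2
  have h3 := ContMDiffAt.mfderiv (m := ∞) (n := ∞) (fun (q : E × Y) (x : E) => Φ x q.2) Prod.fst h1
    contMDiffAt_fst (by simp)
  simp only [mfderiv_eq_fderiv] at h3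
  have h4 := inTangentCoordinates_model_space (I := 𝓘(ℝ, E)) (I' := 𝓘(ℝ, F₁))
    (Prod.fst : E × Y → E) (fun q => Φ q.1 q.2)
    (fun q => fderiv ℝ (fun x => Φ x q.2) q.1) p
  rw [← h4]
  exact h3

variable {Z : Type*} [TopologicalSpace Z] [T2Space Z] [MeasurableSpace Z] [BorelSpace Z]

/-- Differentiation under the integral yields an integral of the same shape, with Φ replaced by its
derivative in a fixed direction, so induction on n applies. The operator factor m need only be
continuous in z: it carries the part of the integrand that does not depend on x. -/
theorem contDiffOn_integral [FiniteDimensional ℝ E]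
    {ν : Measure Z} [IsFiniteMeasureOnCompacts ν] {S : Set Z} (hS : IsCompact S)
    {σ : Z → Y} (hσ : Continuous σ) {m : Z → F₁ →L[ℝ] F₂} (hm : Continuous m)
    {Ω : Set E} (hΩ : IsOpen Ω) {Φ : E → Y → F₁}
    (hΦ : ∀ x ∈ Ω, ∀ y, ContMDiffAt (𝓘(ℝ, E).prod 𝓘(ℝ, E)) 𝓘(ℝ, F₁) ∞
      (Function.uncurry Φ) (x, y)) (n : ℕ) :
    ContDiffOn ℝ n (fun x => ∫ z in S, m z (Φ x (σ z)) ∂ν) Ω := by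
  have : ProperSpace E := FiniteDimensional.proper ℝ E
  have hcont : ∀ {Φ : E → Y → F₁}, (∀ x ∈ Ω, ∀ y, ContMDiffAt (𝓘(ℝ, E).prod 𝓘(ℝ, E))
      𝓘(ℝ, F₁) ∞ (Function.uncurry Φ) (x, y)) → ∀ x ∈ Ω,
      Continuous fun z => m z (Φ x (σ z)) := by
    intro Φ hΦ x hx
    refine hm.clm_apply (continuous_iff_continuousAt.2 fun z => ?_)
    exact ContinuousAt.comp (f := fun z => (x, σ z)) (hΦ x hx (σ z)).continuousAt
      (by fun_prop)
  have hderiv : ∀ {Φ : E → Y → F₁}, (∀ x ∈ Ω, ∀ y, ContMDiffAt (𝓘(ℝ, E).prod 𝓘(ℝ, E))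
      𝓘(ℝ, F₁) ∞ (Function.uncurry Φ) (x, y)) → ∀ x ∈ Ω,
      HasFDerivAt (fun x => ∫ z in S, m z (Φ x (σ z)) ∂ν)
        (∫ z in S, (m z).comp (fderiv ℝ (fun x => Φ x (σ z)) x) ∂ν) x ∧
      IntegrableOn (fun z => (m z).comp (fderiv ℝ (fun x => Φ x (σ z)) x)) S ν := by
    intro Φ hΦ x hx
    obtain ⟨ε, hε, hb⟩ := Metric.nhds_basis_closedBall.mem_iff.1 (hΩ.mem_nhds hx)
    have hD : ContinuousOn (fun q : E × Z =>
        (m q.2).comp (fderiv ℝ (fun x => Φ x (σ q.2)) q.1)) (Ω ×ˢ univ) := by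
      refine ContinuousOn.clm_comp (by fun_prop) ?_
      rintro ⟨x, z⟩ ⟨hx, -⟩
      refine ContinuousAt.continuousWithinAt ?_
      exact ContinuousAt.comp (f := fun q : E × Z => (q.1, σ q.2)) (x := (x, z))
        (contMDiffAt_fderiv_fst (hΦ x hx (σ z))).continuousAt (by fun_prop)
    have hDx : ∀ x ∈ Ω, ContinuousOn
        (fun z => (m z).comp (fderiv ℝ (fun x => Φ x (σ z)) x)) S := fun x hx =>
      hD.comp (f := fun z => (x, z)) (by fun_prop) (fun z _ => ⟨hx, mem_univ _⟩)
    -- The derivative is jointly continuous, so its bound on a compact product is the constant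
    -- dominating function.
    obtain ⟨B, hB'⟩ := ((isCompact_closedBall x ε).prod hS).bddAbove_image
      (hD.norm.mono (prod_mono hb (subset_univ _)))
    have hB : ∀ y ∈ Metric.closedBall x ε, ∀ z ∈ S,
        ‖(m z).comp (fderiv ℝ (fun x => Φ x (σ z)) y)‖ ≤ B := fun y hy z hz =>
      hB' ⟨(y, z), ⟨hy, hz⟩, rfl⟩
    refine ⟨hasFDerivAt_integral_of_dominated_of_fderiv_le (bound := fun _ => B)
      (F := fun x z => m z (Φ x (σ z)))
      (F' := fun x z => (m z).comp (fderiv ℝ (fun x => Φ x (σ z)) x))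
      (Metric.closedBall_mem_nhds x hε) ?_ ?_ ?_ ?_ ?_ ?_, (hDx x hx).integrableOn_compact hS⟩
    · filter_upwards [hΩ.mem_nhds hx] with y hy
      exact (hcont hΦ y hy).continuousOn.aestronglyMeasurable_of_isCompact hS hS.measurableSet
    · exact (hcont hΦ x hx).continuousOn.integrableOn_compact hS
    · exact (hDx x hx).aestronglyMeasurable_of_isCompact hS hS.measurableSet
    · filter_upwards [ae_restrict_mem hS.measurableSet] with z hz y hy
      exact hB y hy z hz
    · exact continuousOn_const.integrableOn_compact hS
    · refine .of_forall fun z y hy => ?_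
      have h1 : ContMDiffAt 𝓘(ℝ, E) 𝓘(ℝ, F₁) ∞ (fun x => Φ x (σ z)) y :=
        ContMDiffAt.comp y (g := Function.uncurry Φ) (f := fun x => (x, σ z))
          (hΦ y (hb hy) (σ z)) (contMDiffAt_id.prodMk contMDiffAt_const)
      exact (m z).hasFDerivAt.comp y
        (h1.contDiffAt.differentiableAt (by simp)).hasFDerivAt
  induction n generalizing Φ with
  | zero =>
    exact contDiffOn_zero.2 fun x hx => (hderiv hΦ x hx).1.continuousAt.continuousWithinAt
  | succ n ih =>
    push_cast
    refine contDiffOn_succ_of_fderiv_apply (fun x hx =>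
      (hderiv hΦ x hx).1.differentiableAt.differentiableWithinAt) (by simp) fun v => ?_
    have h1 := ih (Φ := fun x y => fderiv ℝ (fun x => Φ x y) x v) fun x hx y =>
      (contMDiffAt_fderiv_fst (hΦ x hx y)).clm_apply contMDiffAt_const
    refine h1.congr fun x hx => ?_
    rw [fderivWithin_of_isOpen hΩ hx, (hderiv hΦ x hx).1.fderiv,
      ContinuousLinearMap.integral_apply (hderiv hΦ x hx).2]
    rfl

/-- The integral of a smooth function over a compact set of parameters is smooth. -/
theorem contMDiff_integral [FiniteDimensional ℝ E]
    {X : Type*} [TopologicalSpace X] [ChartedSpace E X] [IsManifold 𝓘(ℝ, E) ∞ X]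
    {ν : Measure Z} [IsFiniteMeasureOnCompacts ν] {S : Set Z} (hS : IsCompact S)
    {σ : Z → Y} (hσ : Continuous σ) {m : Z → F₁ →L[ℝ] F₂} (hm : Continuous m)
    {Φ : X → Y → F₁}
    (hΦ : ContMDiff (𝓘(ℝ, E).prod 𝓘(ℝ, E)) 𝓘(ℝ, F₁) ∞ (Function.uncurry Φ)) :
    ContMDiff 𝓘(ℝ, E) 𝓘(ℝ, F₂) ∞ (fun x => ∫ z in S, m z (Φ x (σ z)) ∂ν) := by
  intro x
  have hx := mem_chart_source E x
  have hsm := contMDiffOn_chart_symm (I := 𝓘(ℝ, E)) (n := ∞) (x := x)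
  have h1 : ContDiffOn ℝ ∞ (fun t => ∫ z in S, m z (Φ ((chartAt E x).symm t) (σ z)) ∂ν)
      (chartAt E x).target := by
    refine contDiffOn_infty.2 fun n => contDiffOn_integral hS hσ hm (chartAt E x).open_target
      (Φ := fun t y => Φ ((chartAt E x).symm t) y) (fun t ht y => ?_) n
    have h2 : ContMDiffAt 𝓘(ℝ, E) 𝓘(ℝ, E) ∞ (chartAt E x).symm t :=
      hsm.contMDiffAt ((chartAt E x).open_target.mem_nhds ht)
    have h3 : ContMDiffAt (𝓘(ℝ, E).prod 𝓘(ℝ, E)) (𝓘(ℝ, E).prod 𝓘(ℝ, E)) ∞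
        (fun q : E × Y => ((chartAt E x).symm q.1, q.2)) (t, y) :=
      (ContMDiffAt.comp (t, y) (g := (chartAt E x).symm) (f := Prod.fst) h2
        contMDiffAt_fst).prodMk contMDiffAt_snd
    exact ContMDiffAt.comp (t, y) (g := Function.uncurry Φ) (hΦ _) h3
  have h4 : ContMDiffAt 𝓘(ℝ, E) 𝓘(ℝ, E) ∞ (chartAt E x) x :=
    (contMDiffOn_chart (I := 𝓘(ℝ, E)) (n := ∞) (x := x)).contMDiffAt
      ((chartAt E x).open_source.mem_nhds hx)
  have h5 := (h1.contDiffAt ((chartAt E x).open_target.mem_nhds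
    ((chartAt E x).map_source hx))).contMDiffAt
  refine (ContMDiffAt.comp x h5 h4).congr_of_eventuallyEq ?_
  filter_upwards [(chartAt E x).open_source.mem_nhds hx] with y hy
  simp [(chartAt E x).left_inv hy]

end ParametricIntegral

/-! ### Elementary facts on unitary representations. -/

section Representations

variable {G : Type u} [Group G] [TopologicalSpace G]
  {𝓗 : Type u} [NormedAddCommGroup 𝓗] [InnerProductSpace ℂ 𝓗]

theorem UnitaryRep.map_mul_apply (π : UnitaryRep G 𝓗) (g h : G) (ξ : 𝓗) :
    π.toHom (g * h) ξ = π.toHom g (π.toHom h ξ) := by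
  rw [map_mul]; rfl

theorem UnitaryRep.map_one_apply (π : UnitaryRep G 𝓗) (ξ : 𝓗) : π.toHom 1 ξ = ξ := by
  rw [map_one]; rfl

theorem UnitaryRep.apply_inv_apply (π : UnitaryRep G 𝓗) (g : G) (ξ : 𝓗) :
    π.toHom g (π.toHom g⁻¹ ξ) = ξ := by
  rw [← π.map_mul_apply, mul_inv_cancel, π.map_one_apply]

theorem UnitaryRep.inner_apply_right (π : UnitaryRep G 𝓗) (g : G) (ξ η : 𝓗) :
    inner ℂ ξ (π.toHom g η) = inner ℂ (π.toHom g⁻¹ ξ) η := by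
  rw [← (π.toHom g).inner_map_map (π.toHom g⁻¹ ξ), π.apply_inv_apply]

theorem UnitaryRep.continuous_apply (π : UnitaryRep G 𝓗) {X : Type*} [TopologicalSpace X]
    {γ : X → G} {f : X → 𝓗} (hγ : Continuous γ) (hf : Continuous f) :
    Continuous fun x => π.toHom (γ x) (f x) := by
  refine continuous_iff_continuousAt.2 fun x => ?_
  rw [ContinuousAt, tendsto_iff_norm_sub_tendsto_zero]
  have h1 : Tendsto (fun y => ‖f y - f x‖ + ‖π.toHom (γ y) (f x) - π.toHom (γ x) (f x)‖)
      (𝓝 x) (𝓝 (0 + 0)) :=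
    (tendsto_iff_norm_sub_tendsto_zero.1 hf.continuousAt).add
      (tendsto_iff_norm_sub_tendsto_zero.1
        ((π.continuous_orbit (f x)).comp hγ).continuousAt)
  rw [add_zero] at h1
  refine squeeze_zero (fun _ => norm_nonneg _) (fun y => ?_) h1
  calc ‖π.toHom (γ y) (f y) - π.toHom (γ x) (f x)‖
      = ‖π.toHom (γ y) (f y - f x) + (π.toHom (γ y) (f x) - π.toHom (γ x) (f x))‖ := by
        rw [map_sub]; congr 1; abel
    _ ≤ _ := (norm_add_le _ _).trans_eq (by rw [LinearIsometryEquiv.norm_map])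

theorem isKFinite_of_invariant (π : UnitaryRep G 𝓗) {K : Subgroup G} {ξ : 𝓗}
    (h : ∀ k ∈ K, π.toHom k ξ = ξ) :
    π.IsKFinite K ξ := by
  have : (fun k : G => π.toHom k ξ) '' (K : Set G) ⊆ {ξ} := by
    rintro _ ⟨k, hk, rfl⟩
    exact h k hk
  exact FiniteDimensional.span_of_finite ℂ ((finite_singleton ξ).subset this)

end Representations

/-! ### Bi-invariant coefficients from vector-valued left regular representations. -/

section LeftRegular

variable {G : Type u} [Group G] [TopologicalSpace G] [IsTopologicalGroup G]
  [LocallyCompactSpace G] [MeasurableSpace G] [BorelSpace G]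
  (μ : Measure G) [μ.IsHaarMeasure] [μ.Regular]
  (𝓗 : Type u) [NormedAddCommGroup 𝓗] [InnerProductSpace ℂ 𝓗]

/-- The left regular representation of `G` on `L²(G, 𝓗)`. -/
def leftRegular : UnitaryRep G (Lp 𝓗 2 μ) where
  toHom :=
    { toFun := fun g =>
        { toFun := fun f => DomMulAct.mk g⁻¹ • f
          invFun := fun f => DomMulAct.mk g • f
          map_add' := fun f f' => smul_add _ f f'
          map_smul' := fun c f => smul_comm _ c f
          left_inv := fun f => by
            change DomMulAct.mk g • DomMulAct.mk g⁻¹ • f = f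
            rw [smul_smul, ← DomMulAct.mk_mul, inv_mul_cancel, DomMulAct.mk_one, one_smul]
          right_inv := fun f => by
            change DomMulAct.mk g⁻¹ • DomMulAct.mk g • f = f
            rw [smul_smul, ← DomMulAct.mk_mul, mul_inv_cancel, DomMulAct.mk_one, one_smul]
          norm_map' := fun f => DomMulAct.norm_smul_Lp _ f }
      map_one' := by
        ext1 f
        change DomMulAct.mk (1 : G)⁻¹ • f = f
        rw [inv_one, DomMulAct.mk_one, one_smul]
      map_mul' := fun g h => by
        ext1 f
        change DomMulAct.mk (g * h)⁻¹ • f = DomMulAct.mk g⁻¹ • DomMulAct.mk h⁻¹ • f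
        rw [smul_smul, ← DomMulAct.mk_mul, mul_inv_rev] }
  continuous_orbit := fun f => by
    change Continuous fun g : G => DomMulAct.mk g⁻¹ • f
    have : Fact ((2 : ℝ≥0∞) ≠ ⊤) := ⟨by simp⟩
    exact (DomMulAct.continuous_mk.comp continuous_inv).smul continuous_const

variable {𝓗}

theorem leftRegular_coeff {f₁ f₂ : G → 𝓗} (h₁ : MemLp f₁ 2 μ) (h₂ : MemLp f₂ 2 μ) (g : G) :
    (leftRegular μ 𝓗).coeff (h₁.toLp f₁) (h₂.toLp f₂) g =
      ∫ y, inner ℂ (f₂ y) (f₁ (g⁻¹ * y)) ∂μ := by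
  change inner ℂ (h₂.toLp f₂) (DomMulAct.mk g⁻¹ • h₁.toLp f₁) = _
  rw [L2.inner_def]
  refine integral_congr_ae ?_
  rw [DomMulAct.mk_smul_toLp]
  filter_upwards [h₂.coeFn_toLp,
    (h₁.comp_measurePreserving (measurePreserving_smul g⁻¹ μ)).coeFn_toLp] with y hy hy'
  exact congrArg₂ (inner ℂ) hy hy'

variable [CompleteSpace 𝓗]

/-- If `v`, `w` are `K`-equivariant compactly supported functions from `G` to the space of `π`,
then `g ↦ ∫ ⟨π(g) v(g⁻¹ y), w(y)⟩ dy` is a `K`-bi-invariant matrix coefficient. -/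
theorem integral_inner_mem_biInvariantCoefficients (π : UnitaryRep G 𝓗) (K : Subgroup G)
    {v w : G → 𝓗} (hv : Continuous v) (hv' : HasCompactSupport v)
    (hvK : ∀ k ∈ K, ∀ y, v (k * y) = π.toHom k (v y))
    (hw : Continuous w) (hw' : HasCompactSupport w)
    (hwK : ∀ k ∈ K, ∀ y, w (k * y) = π.toHom k (w y)) :
    (fun g => ∫ y, inner ℂ (w y) (π.toHom g (v (g⁻¹ * y))) ∂μ) ∈ biInvariantCoefficients K := by
  -- Fell absorption: translating y ↦ π(y⁻¹)v(y) by g gives y ↦ π(y⁻¹)π(g)v(g⁻¹y), so pairing with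
  -- π(y⁻¹)w(y) leaves the factor π(g) and no π(y).
  have hmem : ∀ {v : G → 𝓗}, Continuous v → HasCompactSupport v →
      MemLp (fun y => π.toHom y⁻¹ (v y)) 2 μ := by
    intro v hv hv'
    refine (π.continuous_apply continuous_inv hv).memLp_of_hasCompactSupport ?_
    refine HasCompactSupport.intro hv' fun y hy => ?_
    rw [image_eq_zero_of_notMem_tsupport hy, map_zero]
  refine ⟨⟨Lp 𝓗 2 μ, inferInstance, inferInstance, inferInstance, leftRegular μ 𝓗,
    (hmem hv hv').toLp _, (hmem hw hw').toLp _, ?_⟩, ?_⟩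
  · funext g
    rw [leftRegular_coeff]
    refine integral_congr_ae (.of_forall fun y => ?_)
    dsimp only
    rw [← π.inner_apply_right, ← π.map_mul_apply, mul_inv_rev, inv_inv, mul_inv_cancel_left]
  · intro k₁ hk₁ k₂ hk₂ g
    dsimp only
    -- After the substitution y ↦ k₁y, the equivariance of w absorbs k₁ and that of v absorbs k₂.
    rw [← integral_mul_left_eq_self _ k₁]
    refine integral_congr_ae (.of_forall fun y => ?_)
    dsimp only
    rw [hwK k₁ hk₁, show (k₁ * g * k₂)⁻¹ * (k₁ * y) = k₂⁻¹ * (g⁻¹ * y) by group,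
      hvK _ (inv_mem hk₂), ← π.map_mul_apply, mul_inv_cancel_right, π.map_mul_apply,
      LinearIsometryEquiv.inner_map_map]

end LeftRegular

/-! ### Averaging over K: bi-invariant coefficients are K-finite. -/

section BiInvariant

variable {G : Type u} [Group G] [TopologicalSpace G] [IsTopologicalGroup G]
  [MeasurableSpace G] [BorelSpace G]
  {𝓗 : Type u} [NormedAddCommGroup 𝓗] [InnerProductSpace ℂ 𝓗]
  {K : Subgroup G} (ν : Measure K) [ν.IsMulLeftInvariant]

/-- A continuous function on a compact space is integrable for a finite measure. -/
theorem integrable_of_continuous_of_compactSpace {X F : Type*} [TopologicalSpace X]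
    [CompactSpace X] [MeasurableSpace X] [OpensMeasurableSpace X] [NormedAddCommGroup F]
    (ρ : Measure X) [IsFiniteMeasure ρ] {f : X → F} (hf : Continuous f) : Integrable f ρ :=
  hf.integrable_of_hasCompactSupport (HasCompactSupport.of_compactSpace f)

theorem apply_integral_orbit (π : UnitaryRep G 𝓗) (ξ : 𝓗) (k : K) :
    π.toHom k (∫ l : K, π.toHom l ξ ∂ν) = ∫ l : K, π.toHom l ξ ∂ν := by
  calc π.toHom k (∫ l : K, π.toHom l ξ ∂ν) = ∫ l : K, π.toHom k (π.toHom l ξ) ∂ν :=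
        ((π.toHom k).toContinuousLinearEquiv.integral_comp_comm _).symm
    _ = ∫ l : K, (fun l : K => π.toHom l ξ) (k * l) ∂ν := by
        simp only [Subgroup.coe_mul, π.map_mul_apply]
    _ = _ := integral_mul_left_eq_self (fun l : K => π.toHom l ξ) k

variable [CompactSpace K] [IsProbabilityMeasure ν]

include ν in
/-- Bi-invariant coefficients are `K`-finite coefficients: average the two vectors over `K`. -/
theorem biInvariantCoefficients_subset_kFiniteCoefficients :
    biInvariantCoefficients K ⊆ kFiniteCoefficients K := by
  rintro φ ⟨⟨𝓗, _, _, _, π, ξ, η, rfl⟩, hinv⟩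
  have hint : ∀ ξ : 𝓗, Integrable (fun l : K => π.toHom l ξ) ν := fun ξ =>
    integrable_of_continuous_of_compactSpace ν (π.continuous_apply continuous_subtype_val
      continuous_const)
  refine ⟨𝓗, _, _, ‹_›, π, ∫ l : K, π.toHom l ξ ∂ν, ∫ l : K, π.toHom l η ∂ν,
    isKFinite_of_invariant π fun k hk => apply_integral_orbit ν π ξ ⟨k, hk⟩,
    isKFinite_of_invariant π fun k hk => apply_integral_orbit ν π η ⟨k, hk⟩, ?_⟩
  funext g
  change π.coeff ξ η g = inner ℂ (∫ l : K, π.toHom l η ∂ν) (π.toHom g (∫ l : K, π.toHom l ξ ∂ν))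
  have h1 : π.toHom g (∫ l : K, π.toHom l ξ ∂ν) = ∫ l : K, π.toHom (g * l) ξ ∂ν := by
    simp only [π.map_mul_apply]
    exact ((π.toHom g).toContinuousLinearEquiv.integral_comp_comm _).symm
  have hint2 : Integrable (fun l : K => π.toHom (g * l) ξ) ν :=
    integrable_of_continuous_of_compactSpace ν (π.continuous_apply (by fun_prop) continuous_const)
  -- The integrand is the coefficient at k⁻¹gl, which by bi-invariance is constant in l and in k;
  -- the total mass is one.
  have h3 : ∀ k : K, inner ℂ (π.toHom k η) (∫ l : K, π.toHom (g * l) ξ ∂ν) =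
      π.coeff ξ η g := by
    intro k
    rw [← integral_inner hint2]
    calc ∫ l : K, inner ℂ (π.toHom k η) (π.toHom (g * l) ξ) ∂ν = ∫ _l : K, π.coeff ξ η g ∂ν := by
          refine integral_congr_ae (.of_forall fun l => ?_)
          dsimp only
          rw [← hinv _ (inv_mem k.2) _ l.2 g, UnitaryRep.coeff, mul_assoc, π.map_mul_apply _ (g * l),
            π.inner_apply_right _ η, inv_inv]
      _ = _ := by simp
  rw [h1, ← inner_conj_symm, ← integral_inner (hint η), ← integral_conj]
  simp only [inner_conj_symm, h3]
  simp

end BiInvariant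

/-- A continuous map from a compact space which is positive on a fibre is positive on the
preimage of a neighbourhood. -/
theorem exists_nhds_forall_mem_preimage_pos {X Y : Type*} [TopologicalSpace X] [CompactSpace X]
    [TopologicalSpace Y] [T2Space Y] {C : X → Y} (hC : Continuous C) {D : X → ℝ}
    (hD : Continuous D) {y : Y} (h : ∀ x, C x = y → 0 < D x) :
    ∃ U ∈ 𝓝 y, ∀ x, C x ∈ U → 0 < D x := by
  have hc : IsClosed (C '' {x | D x ≤ 0}) :=
    ((isClosed_le hD continuous_const).isCompact.image hC).isClosed
  refine ⟨(C '' {x | D x ≤ 0})ᶜ, hc.isOpen_compl.mem_nhds ?_, fun x hx => ?_⟩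
  · rintro ⟨x, hx, hxy⟩
    exact (h x hxy).not_ge hx
  · by_contra! hx'
    exact hx ⟨x, hx', rfl⟩

/-- Smooth nonnegative bump functions with small support. -/
theorem exists_contMDiff_bump {E : Type v} [NormedAddCommGroup E] [NormedSpace ℝ E]
    [FiniteDimensional ℝ E] {X : Type u} [TopologicalSpace X] [T2Space X] [ChartedSpace E X]
    [IsManifold 𝓘(ℝ, E) ∞ X] {x : X} {U : Set X} (hU : U ∈ 𝓝 x) :
    ∃ f : X → ℝ, ContMDiff 𝓘(ℝ, E) 𝓘(ℝ, ℝ) ∞ f ∧ HasCompactSupport f ∧ (∀ y, 0 ≤ f y) ∧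
      0 < f x ∧ ∀ y, f y ≠ 0 → y ∈ U := by
  obtain ⟨f, -, hf⟩ := (SmoothBumpFunction.nhds_basis_tsupport (I := 𝓘(ℝ, E)) x).mem_iff.1 hU
  refine ⟨f, f.contMDiff, f.hasCompactSupport, fun y => f.nonneg, ?_, fun y hy =>
    hf (subset_tsupport _ hy)⟩
  rw [f.eq_one]
  exact one_pos

/-! ### Smooth K-equivariant fields with values in a K-stable space. -/

section Fields

variable (E : Type v) [NormedAddCommGroup E] [NormedSpace ℝ E]
  {G : Type u} [Group G] [TopologicalSpace G] [ChartedSpace E G]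
  {𝓗 : Type u} [NormedAddCommGroup 𝓗] [InnerProductSpace ℂ 𝓗]

/-- Smooth compactly supported `K`-equivariant functions `G → V ⊆ 𝓗`. -/
structure IsEquivariantField (π : UnitaryRep G 𝓗) (K : Subgroup G) (V : Submodule ℂ 𝓗)
    (v : G → 𝓗) : Prop where
  contMDiff : ContMDiff 𝓘(ℝ, E) 𝓘(ℝ, 𝓗) ∞ v
  hasCompactSupport : HasCompactSupport v
  equivariant : ∀ k ∈ K, ∀ y, v (k * y) = π.toHom k (v y)
  mem : ∀ y, v y ∈ V

variable {E}

theorem IsEquivariantField.add {π : UnitaryRep G 𝓗} {K : Subgroup G} {V : Submodule ℂ 𝓗}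
    {v w : G → 𝓗} (hv : IsEquivariantField E π K V v) (hw : IsEquivariantField E π K V w) :
    IsEquivariantField E π K V (v + w) where
  contMDiff := hv.contMDiff.add hw.contMDiff
  hasCompactSupport := hv.hasCompactSupport.add hw.hasCompactSupport
  equivariant k hk y := by simp [hv.equivariant k hk, hw.equivariant k hk]
  mem y := V.add_mem (hv.mem y) (hw.mem y)

theorem IsEquivariantField.const_smul {π : UnitaryRep G 𝓗} {K : Subgroup G} {V : Submodule ℂ 𝓗}
    {v : G → 𝓗} (c : ℂ) (hv : IsEquivariantField E π K V v) :
    IsEquivariantField E π K V (c • v) where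
  contMDiff := ((c • ContinuousLinearMap.id ℝ 𝓗).contMDiff).comp hv.contMDiff
  hasCompactSupport := hv.hasCompactSupport.comp_left (g := fun x => c • x) (smul_zero c)
  equivariant k hk y := by simp [hv.equivariant k hk]
  mem y := V.smul_mem c (hv.mem y)

variable {π : UnitaryRep G 𝓗} {K : Subgroup G} [CompactSpace K] [MeasurableSpace G] [BorelSpace G]
  (ν : Measure K) [IsProbabilityMeasure ν]

/-- The average over `K` of the translates of `f ⊗ u`. -/
def averagedField (π : UnitaryRep G 𝓗) (f : G → ℝ) (u : 𝓗) (y : G) : 𝓗 :=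
  ∫ k : K, f ((k : G)⁻¹ * y) • π.toHom k u ∂ν

variable [IsTopologicalGroup G]

theorem integrable_averagedField {f : G → ℝ} (hf : Continuous f) (u : 𝓗) (y : G) :
    Integrable (fun k : K => f ((k : G)⁻¹ * y) • π.toHom k u) ν := by
  refine integrable_of_continuous_of_compactSpace ν ?_
  have h1 : Continuous fun k : K => f ((k : G)⁻¹ * y) := by fun_prop
  exact h1.smul (π.continuous_apply continuous_subtype_val continuous_const)

variable [CompleteSpace 𝓗]

theorem isEquivariantField_averagedField [ν.IsMulLeftInvariant] [T2Space G] [FiniteDimensional ℝ E]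
    [LieGroup 𝓘(ℝ, E) ∞ G] {V : Submodule ℂ 𝓗} [FiniteDimensional ℂ V]
    (hV : ∀ k ∈ K, ∀ u ∈ V, π.toHom k u ∈ V) {f : G → ℝ}
    (hf : ContMDiff 𝓘(ℝ, E) 𝓘(ℝ, ℝ) ∞ f) (hf' : HasCompactSupport f) {u : 𝓗} (hu : u ∈ V) :
    IsEquivariantField E π K V (averagedField ν π f u) where
  contMDiff := by
    -- The map k ↦ π(k)u is used only as a continuous map, so it goes into the operator factor; all
    -- the smoothness comes from the scalar f(k⁻¹y).
    have hm : Continuous fun k : K =>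
        ContinuousLinearMap.smulRight (1 : ℝ →L[ℝ] ℝ) (π.toHom k u) :=
      (ContinuousLinearMap.smulRightL ℝ ℝ 𝓗 1).continuous.comp
        (π.continuous_apply continuous_subtype_val continuous_const)
    have hΦ : ContMDiff (𝓘(ℝ, E).prod 𝓘(ℝ, E)) 𝓘(ℝ, ℝ) ∞
        (Function.uncurry fun (y : G) (k : G) => f (k⁻¹ * y)) :=
      hf.comp ((contMDiff_snd.inv).mul contMDiff_fst)
    have h := contMDiff_integral (ν := ν) isCompact_univ continuous_subtype_val hm hΦ
    simp only [Measure.restrict_univ] at h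
    exact h
  hasCompactSupport := by
    have hc : IsCompact ((K : Set G) * tsupport f) :=
      (isCompact_iff_compactSpace.2 ‹_›).mul hf'
    refine HasCompactSupport.intro hc fun y hy => ?_
    rw [averagedField]
    refine integral_eq_zero_of_ae (.of_forall fun k => ?_)
    have : f ((k : G)⁻¹ * y) = 0 := by
      by_contra h
      exact hy ⟨k, k.2, (k : G)⁻¹ * y, subset_tsupport _ h, by simp⟩
    simp [this]
  equivariant k₀ hk₀ y := by
    rw [averagedField, averagedField]
    have h1 := (π.toHom k₀).toContinuousLinearEquiv.integral_comp_comm (μ := ν)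
      (fun k : K => f ((k : G)⁻¹ * y) • π.toHom k u)
    refine Eq.trans ?_ h1
    rw [← integral_mul_left_eq_self _ (⟨k₀, hk₀⟩ : K)]
    refine integral_congr_ae (.of_forall fun k => ?_)
    have e : π.toHom k₀ (f ((k : G)⁻¹ * y) • π.toHom k u) =
        f ((k : G)⁻¹ * y) • π.toHom k₀ (π.toHom k u) :=
      (((π.toHom k₀).toContinuousLinearEquiv.toContinuousLinearMap).restrictScalars ℝ).map_smul _ _
    refine Eq.trans ?_ e.symm
    simp only [Subgroup.coe_mul, ← π.map_mul_apply]
    congr 2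
    group
  mem y := by
    have hVc : IsClosed (V : Set 𝓗) := V.closed_of_finiteDimensional
    refine (V.restrictScalars ℝ).convex.integral_mem hVc (.of_forall fun k => ?_)
      (integrable_averagedField ν hf.continuous u y)
    exact (V.restrictScalars ℝ).smul_mem _ (hV k k.2 u hu)

theorem inner_apply_averagedField {f : G → ℝ} (hf : Continuous f) (u h : 𝓗) (L : 𝓗 →L[ℂ] 𝓗)
    (y : G) : (inner ℂ h (L (averagedField ν π f u y))).re =
      ∫ k : K, f ((k : G)⁻¹ * y) * (inner ℂ h (L (π.toHom k u))).re ∂ν := by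
  have h1 := (Complex.reCLM.comp (((innerSL ℂ h).comp L).restrictScalars ℝ)).integral_comp_comm
    (integrable_averagedField (π := π) ν hf u y)
  refine h1.symm.trans (integral_congr_ae (.of_forall fun k => ?_))
  simp

theorem re_inner_averagedField_nonneg {f : G → ℝ} (hf : Continuous f) (hf0 : ∀ y, 0 ≤ f y)
    {u h : 𝓗} {L : 𝓗 →L[ℂ] 𝓗} {y : G}
    (hpos : ∀ k : K, f ((k : G)⁻¹ * y) ≠ 0 → 0 ≤ (inner ℂ h (L (π.toHom k u))).re) :
    0 ≤ (inner ℂ h (L (averagedField ν π f u y))).re := by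
  rw [inner_apply_averagedField ν hf]
  refine integral_nonneg fun k => ?_
  by_cases hk : f ((k : G)⁻¹ * y) = 0
  · simp [hk]
  · exact mul_nonneg (hf0 _) (hpos k hk)

/-- The integrand is continuous, nonnegative, and positive at k = 1, and ν charges open sets. -/
theorem re_inner_averagedField_pos [ν.IsOpenPosMeasure] {f : G → ℝ} (hf : Continuous f)
    (hf0 : ∀ y, 0 ≤ f y) {u h : 𝓗} {L : 𝓗 →L[ℂ] 𝓗} {y : G}
    (hpos : ∀ k : K, f ((k : G)⁻¹ * y) ≠ 0 → 0 < (inner ℂ h (L (π.toHom k u))).re)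
    (hy : f y ≠ 0) :
    0 < (inner ℂ h (L (averagedField ν π f u y))).re := by
  rw [inner_apply_averagedField ν hf]
  have hc : Continuous fun k : K => f ((k : G)⁻¹ * y) * (inner ℂ h (L (π.toHom k u))).re := by
    have := π.continuous_apply (continuous_subtype_val (p := (· ∈ K)))
      (continuous_const (y := u))
    fun_prop
  refine hc.integral_pos_of_hasCompactSupport_nonneg_nonzero (.of_compactSpace _) (fun k => ?_)
    (x := 1) ?_
  · by_cases hk : f ((k : G)⁻¹ * y) = 0
    · simp [hk]
    · exact mul_nonneg (hf0 _) (hpos k hk).le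
  · have h1 := hpos 1 (by simpa using hy)
    exact mul_ne_zero (by simpa using hy) h1.ne'

variable [ν.IsMulLeftInvariant] [ν.IsOpenPosMeasure]

include ν in
/-- Every vector of a finite-dimensional representation of `K` is the value at `1` of an
equivariant field. -/
theorem exists_isEquivariantField_one_eq [T2Space G] [FiniteDimensional ℝ E]
    [LieGroup 𝓘(ℝ, E) ∞ G] {V : Submodule ℂ 𝓗} [FiniteDimensional ℂ V]
    (hV : ∀ k ∈ K, ∀ u ∈ V, π.toHom k u ∈ V) {u : 𝓗} (hu : u ∈ V) :
    ∃ v, IsEquivariantField E π K V v ∧ v 1 = u := by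
  -- The attained values form a subspace S of V. If it were proper, a nonzero h in V orthogonal to S
  -- would exist, but averaging a bump near 1 times h gives a value at 1 with positive real pairing
  -- with h.
  let S : Submodule ℂ 𝓗 :=
    { carrier := {h | ∃ v, IsEquivariantField E π K V v ∧ v 1 = h}
      add_mem' := by
        rintro _ _ ⟨v, hv, rfl⟩ ⟨w, hw, rfl⟩
        exact ⟨v + w, hv.add hw, rfl⟩
      zero_mem' := ⟨0, ⟨contMDiff_const, HasCompactSupport.zero, by simp, by simp⟩, rfl⟩
      smul_mem' := by
        rintro c _ ⟨v, hv, rfl⟩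
        exact ⟨c • v, hv.const_smul c, rfl⟩ }
  have hSV : S ≤ V := by
    rintro _ ⟨v, hv, rfl⟩
    exact hv.mem 1
  have : FiniteDimensional ℂ S := Submodule.finiteDimensional_of_le hSV
  change u ∈ S
  by_contra huS
  obtain ⟨h, hhV, hhS, hh0⟩ : ∃ h ∈ V, (∀ s ∈ S, inner ℂ h s = 0) ∧ h ≠ 0 := by
    refine ⟨u - S.starProjection u, V.sub_mem hu (hSV (S.starProjection_apply_mem u)), ?_, ?_⟩
    · intro s hs
      exact S.starProjection_inner_eq_zero u s hs
    · intro h0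
      rw [sub_eq_zero.1 h0] at huS
      exact huS (S.starProjection_apply_mem u)
  have hD : Continuous fun k : K => (inner ℂ h (π.toHom k h)).re := by
    have := π.continuous_apply (continuous_subtype_val (p := (· ∈ K)))
      (continuous_const (y := h))
    fun_prop
  have hpos : 0 < (inner ℂ h h).re := by
    rw [← RCLike.re_eq_complex_re, inner_self_eq_norm_sq]
    positivity
  obtain ⟨U, hU, hUD⟩ := exists_nhds_forall_mem_preimage_pos
    (C := fun k : K => ((k : G)⁻¹ * 1)) (y := 1) (by fun_prop) hD (fun k hk => by
      have hk1 : (k : G) = 1 := by simpa using hk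
      rw [hk1, π.map_one_apply]
      exact hpos)
  obtain ⟨f, hf, hf', hf0, hf1, hfU⟩ := exists_contMDiff_bump (E := E) hU
  have h1 := re_inner_averagedField_pos (π := π) ν hf.continuous hf0 (u := h) (h := h)
    (L := ContinuousLinearMap.id ℂ 𝓗) (y := 1) (fun k hk => hUD k (hfU _ hk)) hf1.ne'
  have h2 := hhS _ ⟨_, isEquivariantField_averagedField ν hV hf hf' hhV, rfl⟩
  rw [ContinuousLinearMap.id_apply, h2] at h1
  simp at h1

end Fields

/-! ### Separating M-intertwiners by equivariant fields. -/

section Separation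

variable {E : Type v} [NormedAddCommGroup E] [NormedSpace ℝ E] [FiniteDimensional ℝ E]
  {G : Type u} [Group G] [TopologicalSpace G] [T2Space G] [ChartedSpace E G]
  [LieGroup 𝓘(ℝ, E) ∞ G] [IsTopologicalGroup G]
  {𝓗 : Type u} [NormedAddCommGroup 𝓗] [InnerProductSpace ℂ 𝓗] [CompleteSpace 𝓗]
  {π : UnitaryRep G 𝓗} {K : Subgroup G} [CompactSpace K] [MeasurableSpace G] [BorelSpace G]
  (ν : Measure K) [IsProbabilityMeasure ν] [ν.IsMulLeftInvariant] [ν.IsOpenPosMeasure]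
  (μ : Measure G) [μ.IsHaarMeasure]

-- Let v be the averaged field of a bump near 1 times u, and w the K-average of y ↦ T v(b⁻¹y). Since
-- w is the equivariant part of that function, the pairing is ∫ ‖w‖², so only w(b) ≠ 0 is needed. A
-- pair (k, l) contributes to w(b) only if l⁻¹b⁻¹k⁻¹b is near 1. In the limit case k⁻¹bl⁻¹ = b the
-- hypothesis on b forces k⁻¹ = l ∈ M, and M-equivariance gives ⟨T u, π(k) T π(l) u⟩ = ‖T u‖² > 0.
include ν in
theorem exists_field_integral_inner_ne_zero {M : Subgroup G} {V W : Submodule ℂ 𝓗}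
    [FiniteDimensional ℂ V] [FiniteDimensional ℂ W]
    (hV : ∀ k ∈ K, ∀ u ∈ V, π.toHom k u ∈ V) (hW : ∀ k ∈ K, ∀ u ∈ W, π.toHom k u ∈ W)
    {b : G} (hb : ∀ k ∈ K, ∀ l ∈ K, k * b * l⁻¹ = b → k = l ∧ k ∈ M)
    {T : 𝓗 →L[ℂ] 𝓗} (hTW : ∀ h, T h ∈ W) (hTM : ∀ m ∈ M, ∀ h, T (π.toHom m h) = π.toHom m (T h))
    {u : 𝓗} (hu : u ∈ V) (hTu : T u ≠ 0) :
    ∃ v w : G → 𝓗, IsEquivariantField E π K V v ∧ Continuous w ∧ HasCompactSupport w ∧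
      (∀ k ∈ K, ∀ y, w (k * y) = π.toHom k (w y)) ∧ (∀ y, w y ∈ W) ∧
      ∫ y, inner ℂ (w y) (T (v (b⁻¹ * y))) ∂μ ≠ 0 := by
  have hD : Continuous fun p : K × K =>
      (inner ℂ (T u) (π.toHom p.1 (T (π.toHom p.2 u)))).re := by
    have h1 : Continuous fun p : K × K => π.toHom p.1 (T (π.toHom p.2 u)) :=
      π.continuous_apply (by fun_prop)
        (T.continuous.comp (π.continuous_apply (by fun_prop) continuous_const))
    fun_prop
  -- Positivity on the fibre over 1 spreads to the preimage of a neighbourhood U by compactness of K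
  -- × K; the bump is then supported in U.
  obtain ⟨U, hU, hUD⟩ := exists_nhds_forall_mem_preimage_pos
    (C := fun p : K × K => (p.2 : G)⁻¹ * (b⁻¹ * ((p.1 : G)⁻¹ * b))) (y := 1) (by fun_prop) hD
    (fun p hp => by
      obtain ⟨h1, h2⟩ := hb (p.1 : G)⁻¹ (inv_mem p.1.2) p.2 p.2.2 (by
        have h3 : b⁻¹ * ((p.1 : G)⁻¹ * b) = p.2 := by
          rw [inv_mul_eq_one] at hp
          exact hp.symm
        rw [← h3]
        group)
      rw [← h1, hTM _ h2, π.apply_inv_apply, ← RCLike.re_eq_complex_re, inner_self_eq_norm_sq]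
      positivity)
  obtain ⟨f, hf, hf', hf0, hf1, hfU⟩ := exists_contMDiff_bump (E := E) hU
  set v := averagedField ν π f u
  have hvF : IsEquivariantField E π K V v :=
    isEquivariantField_averagedField ν hV hf hf' hu
  have hvc : Continuous v := hvF.contMDiff.continuous
  have hjoint : Continuous fun p : G × K => π.toHom p.2 (T (v (b⁻¹ * ((p.2 : G)⁻¹ * p.1)))) :=
    π.continuous_apply (by fun_prop) (by fun_prop)
  have hint : ∀ y, Integrable (fun k : K => π.toHom k (T (v (b⁻¹ * ((k : G)⁻¹ * y))))) ν :=
    fun y => integrable_of_continuous_of_compactSpace ν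
      (hjoint.comp (by fun_prop : Continuous fun k : K => (y, k)))
  set w : G → 𝓗 := fun y => ∫ k : K, π.toHom k (T (v (b⁻¹ * ((k : G)⁻¹ * y)))) ∂ν with hw
  have hwc : Continuous w := by
    rw [← continuousOn_univ]
    exact continuousOn_integral_of_compact_support isCompact_univ hjoint.continuousOn
      (fun p x _ hx => absurd (mem_univ x) hx)
  have hws : HasCompactSupport w := by
    have hc : IsCompact ((K : Set G) * ({b} * tsupport v)) :=
      (isCompact_iff_compactSpace.2 ‹_›).mul (isCompact_singleton.mul hvF.hasCompactSupport)
    refine HasCompactSupport.intro hc fun y hy => ?_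
    refine integral_eq_zero_of_ae (.of_forall fun k => ?_)
    have : v (b⁻¹ * ((k : G)⁻¹ * y)) = 0 := by
      by_contra h
      exact hy ⟨k, k.2, (k : G)⁻¹ * y, ⟨b, rfl, b⁻¹ * ((k : G)⁻¹ * y),
        subset_tsupport _ h, by simp⟩, by simp⟩
    simp [this]
  have hwK : ∀ k ∈ K, ∀ y, w (k * y) = π.toHom k (w y) := by
    intro k₀ hk₀ y
    refine Eq.trans ?_ ((π.toHom k₀).toContinuousLinearEquiv.integral_comp_comm (μ := ν)
      (fun k : K => π.toHom k (T (v (b⁻¹ * ((k : G)⁻¹ * y))))))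
    simp only [hw]
    rw [← integral_mul_left_eq_self _ (⟨k₀, hk₀⟩ : K)]
    refine integral_congr_ae (.of_forall fun k => ?_)
    change π.toHom (k₀ * k) (T (v (b⁻¹ * ((k₀ * k)⁻¹ * (k₀ * y))))) =
      π.toHom k₀ (π.toHom k (T (v (b⁻¹ * ((k : G)⁻¹ * y)))))
    rw [π.map_mul_apply, show (k₀ * (k : G))⁻¹ * (k₀ * y) = (k : G)⁻¹ * y by group]
  refine ⟨v, w, hvF, hwc, hws, hwK, fun y => ?_, ?_⟩
  · have hWc : IsClosed (W : Set 𝓗) := W.closed_of_finiteDimensional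
    exact (W.restrictScalars ℝ).convex.integral_mem hWc
      (.of_forall fun k => hW k k.2 _ (hTW _)) (hint y)
  -- Averaging over K is self-adjoint and fixes w: insert an integral over K, translate y by k⁻¹,
  -- and exchange the integrals.
  have hI : ∫ y, inner ℂ (w y) (T (v (b⁻¹ * y))) ∂μ = ∫ y, inner ℂ (w y) (w y) ∂μ := by
    calc ∫ y, inner ℂ (w y) (T (v (b⁻¹ * y))) ∂μ
        = ∫ _k : K, (∫ y, inner ℂ (w y) (T (v (b⁻¹ * y))) ∂μ) ∂ν := by simp
      _ = ∫ k : K, (∫ y, inner ℂ (w y) (π.toHom k (T (v (b⁻¹ * ((k : G)⁻¹ * y))))) ∂μ) ∂ν := by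
          refine integral_congr_ae (.of_forall fun k => ?_)
          dsimp only
          rw [← integral_mul_left_eq_self _ (k : G)⁻¹]
          refine integral_congr_ae (.of_forall fun y => ?_)
          dsimp only
          rw [π.inner_apply_right, hwK _ (inv_mem k.2)]
      _ = ∫ y, (∫ k : K, inner ℂ (w y) (π.toHom k (T (v (b⁻¹ * ((k : G)⁻¹ * y))))) ∂ν) ∂μ := by
          refine integral_integral_swap_of_hasCompactSupport ?_ ?_
          · have h1 : Continuous fun p : K × G => w p.2 := by fun_prop
            exact h1.inner (hjoint.comp continuous_swap)
          · refine HasCompactSupport.intro (isCompact_univ.prod hws) fun p hp => ?_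
            have : w p.2 = 0 := image_eq_zero_of_notMem_tsupport fun h => hp ⟨mem_univ _, h⟩
            simp [Function.uncurry, this]
      _ = _ := by
          refine integral_congr_ae (.of_forall fun y => ?_)
          dsimp only
          rw [integral_inner (hint y)]
  have hwb : w b ≠ 0 := by
    intro h0
    have h1 : (inner ℂ (T u) (w b)).re =
        ∫ k : K, (inner ℂ (T u) (π.toHom k (T (v (b⁻¹ * ((k : G)⁻¹ * b)))))).re ∂ν :=
      ((Complex.reCLM.comp ((innerSL ℂ (T u)).restrictScalars ℝ)).integral_comp_comm
        (hint b)).symm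
    have h2 : 0 < ∫ k : K, (inner ℂ (T u) (π.toHom k (T (v (b⁻¹ * ((k : G)⁻¹ * b)))))).re ∂ν := by
      have hc : Continuous fun k : K =>
          (inner ℂ (T u) (π.toHom k (T (v (b⁻¹ * ((k : G)⁻¹ * b)))))).re := by
        have := hjoint.comp (by fun_prop : Continuous fun k : K => (b, k))
        have h3 : Continuous fun k : K => π.toHom k (T (v (b⁻¹ * ((k : G)⁻¹ * b)))) := this
        fun_prop
      refine hc.integral_pos_of_hasCompactSupport_nonneg_nonzero (.of_compactSpace _)
        (fun k => ?_) (x := 1) (ne_of_gt ?_)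
      · exact re_inner_averagedField_nonneg (π := π) ν hf.continuous hf0 (u := u) (h := T u)
          (L := ((π.toHom k).toContinuousLinearEquiv : 𝓗 →L[ℂ] 𝓗).comp T)
          (fun l hl => (hUD (k, l) (hfU _ hl)).le)
      · exact re_inner_averagedField_pos (π := π) ν hf.continuous hf0 (u := u) (h := T u)
          (L := ((π.toHom (1 : K)).toContinuousLinearEquiv : 𝓗 →L[ℂ] 𝓗).comp T)
          (fun l hl => hUD (1, l) (hfU _ hl)) (by simpa using hf1.ne')
    rw [← h1, h0] at h2
    simp at h2
  have hpos : 0 < ∫ y, ‖w y‖ ^ 2 ∂μ := by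
    refine Continuous.integral_pos_of_hasCompactSupport_nonneg_nonzero (by fun_prop) ?_
      (fun y => by positivity) (x := b) (by positivity)
    exact hws.comp_left (g := fun x => ‖x‖ ^ 2) (by simp)
  rw [hI]
  have h4 : ∫ y, inner ℂ (w y) (w y) ∂μ = ((∫ y, ‖w y‖ ^ 2 ∂μ : ℝ) : ℂ) := by
    rw [← integral_complex_ofReal]
    refine integral_congr_ae (.of_forall fun y => ?_)
    dsimp only
    rw [inner_self_eq_norm_sq_to_K]
    push_cast
    rfl
  rw [h4]
  exact_mod_cast hpos.ne'

set_option maxSynthPendingDepth 3 in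
/-- The functional `T ↦ ∫ ⟨T v(g⁻¹ y), w(y)⟩ dy` depends smoothly on `g`. -/
theorem exists_contMDiff_functional (N : Submodule ℂ (𝓗 →L[ℂ] 𝓗))
    {v w : G → 𝓗} (hv : ContMDiff 𝓘(ℝ, E) 𝓘(ℝ, 𝓗) ∞ v) (hw : Continuous w)
    (hw' : HasCompactSupport w) :
    ∃ d : G → N →L[ℂ] ℂ, ContMDiff 𝓘(ℝ, E) 𝓘(ℝ, N →L[ℂ] ℂ) ∞ d ∧
      ∀ g T, d g T = ∫ y, inner ℂ (w y) ((T : 𝓗 →L[ℂ] 𝓗) (v (g⁻¹ * y))) ∂μ := by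
  -- A y sends h to the functional T ↦ ⟨T h, w(y)⟩, so d is an integral of continuous operators
  -- applied to the smooth v(g⁻¹y).
  let A : G → 𝓗 →L[ℂ] N →L[ℂ] ℂ := fun y =>
    (ContinuousLinearMap.compL ℂ N 𝓗 ℂ (innerSL ℂ (w y))).comp N.subtypeL.flip
  have hA : Continuous A := by
    have h1 : Continuous fun y => innerSL ℂ (w y) := (innerSL ℂ).continuous.comp hw
    exact ((ContinuousLinearMap.compL ℂ N 𝓗 ℂ).continuous.comp h1).clm_comp continuous_const
  let m : G → 𝓗 →L[ℝ] N →L[ℂ] ℂ := fun y => (A y).restrictScalars ℝ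
  have hm : Continuous m :=
    (ContinuousLinearMap.restrictScalarsL ℂ 𝓗 (N →L[ℂ] ℂ) ℝ ℝ).continuous.comp hA
  have hΦ : ContMDiff (𝓘(ℝ, E).prod 𝓘(ℝ, E)) 𝓘(ℝ, 𝓗) ∞
      (Function.uncurry fun g y : G => v (g⁻¹ * y)) :=
    hv.comp ((contMDiff_fst.inv).mul contMDiff_snd)
  refine ⟨_, contMDiff_integral (ν := μ) (S := tsupport w) hw' continuous_id hm hΦ,
    fun g T => ?_⟩
  have hvc := hv.continuous
  have hint : IntegrableOn (fun y => m y (v (g⁻¹ * y))) (tsupport w) μ := by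
    refine ContinuousOn.integrableOn_compact hw' (Continuous.continuousOn ?_)
    exact hm.clm_apply (by fun_prop)
  have h1 := ContinuousLinearMap.integral_comp_comm
    ((ContinuousLinearMap.apply ℂ ℂ T).restrictScalars ℝ) hint
  refine h1.symm.trans ?_
  change ∫ y in tsupport w, inner ℂ (w y) ((T : 𝓗 →L[ℂ] 𝓗) (v (g⁻¹ * y))) ∂μ = _
  refine setIntegral_eq_integral_of_forall_compl_eq_zero fun y hy => ?_
  rw [image_eq_zero_of_notMem_tsupport hy, inner_zero_left]

end Separation

/-! ### Smooth reconstruction from separating functionals. -/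

section LinearAlgebra

variable {E : Type*} [NormedAddCommGroup E] [NormedSpace ℝ E]
  {X : Type*} [TopologicalSpace X] [ChartedSpace E X]
  {N : Type*} [NormedAddCommGroup N] [NormedSpace ℂ N] [FiniteDimensional ℂ N]

/-- Smooth families of functionals which separate the points of a finite-dimensional space at one
point allow one to reconstruct vectors smoothly near that point. -/
theorem exists_contMDiffAt_reconstruction {𝒟 : Set (X → N →L[ℂ] ℂ)} {x : X}
    (hsm : ∀ d ∈ 𝒟, ContMDiffAt 𝓘(ℝ, E) 𝓘(ℝ, N →L[ℂ] ℂ) ∞ d x)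
    (hsep : ∀ T : N, T ≠ 0 → ∃ d ∈ 𝒟, d x T ≠ 0) :
    ∃ (n : ℕ) (d : Fin n → X → N →L[ℂ] ℂ) (D : Fin n → X → N), (∀ i, d i ∈ 𝒟) ∧
      (∀ i, ContMDiffAt 𝓘(ℝ, E) 𝓘(ℝ, N) ∞ (D i) x) ∧
      ∀ᶠ y in 𝓝 x, ∀ T, T = ∑ i, d i y T • D i y := by
  have : CompleteSpace N := FiniteDimensional.complete ℂ N
  let s : Set (N →ₗ[ℂ] ℂ) := {ℓ | ∃ d ∈ 𝒟, ℓ = (d x : N →ₗ[ℂ] ℂ)}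
  have hs : Submodule.span ℂ s = ⊤ := by
    -- A proper span would be annihilated by a nonzero element of the bidual, that is, by evaluation
    -- at some T ≠ 0, against separation.
    by_contra hne
    obtain ⟨F, hF0, hF⟩ := Submodule.exists_dual_map_eq_bot_of_lt_top
      (lt_top_iff_ne_top.2 hne) inferInstance
    obtain ⟨T, rfl⟩ := (Module.evalEquiv ℂ N).surjective F
    have hT : T ≠ 0 := by
      rintro rfl
      simp at hF0
    obtain ⟨d, hd, hdT⟩ := hsep T hT
    refine hdT ?_
    have h1 : (Module.evalEquiv ℂ N T) (d x : N →ₗ[ℂ] ℂ) ∈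
        (Submodule.span ℂ s).map (Module.evalEquiv ℂ N T) :=
      Submodule.mem_map_of_mem (Submodule.subset_span ⟨d, hd, rfl⟩)
    rw [hF, Submodule.mem_bot] at h1
    exact h1
  let R : Set (N →ₗ[ℂ] N) := {L | ∃ d ∈ 𝒟, ∃ r : N, L = (d x : N →ₗ[ℂ] ℂ).smulRight r}
  have hR : LinearMap.id ∈ Submodule.span ℂ R := by
    have h1 : ∀ (ℓ : N →ₗ[ℂ] ℂ) (r : N), ℓ.smulRight r ∈ Submodule.span ℂ R := by
      intro ℓ r
      have hℓ : ℓ ∈ Submodule.span ℂ s := hs ▸ Submodule.mem_top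
      induction hℓ using Submodule.span_induction with
      | mem ℓ h =>
        obtain ⟨d, hd, rfl⟩ := h
        exact Submodule.subset_span ⟨d, hd, r, rfl⟩
      | zero =>
        convert! Submodule.zero_mem (Submodule.span ℂ R)
        ext; simp
      | add ℓ ℓ' _ _ h h' =>
        convert! Submodule.add_mem _ h h'
        ext; simp [add_smul]
      | smul c ℓ _ h =>
        convert! Submodule.smul_mem _ c h
        ext; simp [mul_smul]
    let b := Module.finBasis ℂ N
    have h2 : (LinearMap.id : N →ₗ[ℂ] N) = ∑ i, (b.coord i).smulRight (b i) := by
      ext T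
      simp [LinearMap.sum_apply, b.sum_repr]
    rw [h2]
    exact Submodule.sum_mem _ fun i _ => h1 _ _
  obtain ⟨n, c, L, hL⟩ := Submodule.mem_span_set'.1 hR
  choose d hd r hr using fun i => (L i).2
  -- The identity is a combination of rank-one operators built from the d i x. The same combination
  -- at y is A y, with A x = id, hence invertible near x; applying its inverse to c i • r i gives
  -- the reconstruction vectors.
  let A : X → N →L[ℂ] N := fun y => ∑ i, (d i y).smulRight (c i • r i)
  have hAx : A x = ContinuousLinearEquiv.refl ℂ N := by
    ext T
    have h3 := LinearMap.congr_fun hL T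
    simp only [LinearMap.sum_apply, LinearMap.smul_apply, hr] at h3
    simpa [A, smul_comm (c _)] using h3
  have hAs : ContMDiffAt 𝓘(ℝ, E) 𝓘(ℝ, N →L[ℂ] N) ∞ A x := by
    refine contMDiffAt_finsetSum fun i _ => ?_
    let B : (N →L[ℂ] ℂ) →L[ℝ] (N →L[ℂ] N) :=
      ((ContinuousLinearMap.smulRightL ℂ N N).flip (c i • r i)).restrictScalars ℝ
    exact ContMDiffAt.comp x B.contMDiff.contMDiffAt (hsm _ (hd i))
  have hinv : ContMDiffAt 𝓘(ℝ, E) 𝓘(ℝ, N →L[ℂ] N) ∞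
      (fun y => ContinuousLinearMap.inverse (A y)) x := by
    have h4 : ContDiffAt ℝ ∞ (ContinuousLinearMap.inverse : (N →L[ℂ] N) → (N →L[ℂ] N)) (A x) := by
      rw [hAx]
      exact (contDiffAt_map_inverse (𝕜 := ℂ) (n := ∞)
        (ContinuousLinearEquiv.refl ℂ N)).restrict_scalars ℝ
    exact ContMDiffAt.comp x h4.contMDiffAt hAs
  refine ⟨n, d, fun i y => ContinuousLinearMap.inverse (A y) (c i • r i), hd, fun i => ?_, ?_⟩
  · let B : (N →L[ℂ] N) →L[ℝ] N :=
      (ContinuousLinearMap.apply ℂ N (c i • r i)).restrictScalars ℝ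
    exact ContMDiffAt.comp x B.contMDiff.contMDiffAt hinv
  · have h5 : range ((↑) : (N ≃L[ℂ] N) → N →L[ℂ] N) ∈ 𝓝 (A x) := by
      rw [hAx]
      exact ContinuousLinearEquiv.nhds _
    filter_upwards [hAs.continuousAt h5] with y hy T
    obtain ⟨e, he⟩ := hy
    have h6 : ContinuousLinearMap.inverse (A y) (A y T) = T := by
      rw [← he, ContinuousLinearMap.inverse_equiv]
      simp
    conv_lhs => rw [← h6]
    simp only [A, sum_apply, ContinuousLinearMap.smulRight_apply, map_sum,
      map_smul]

end LinearAlgebra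

/-! ### The space Hom_M(V, W) and compressions of π(g). -/

section Intertwiners

variable {G : Type u} [Group G] [TopologicalSpace G]
  {𝓗 : Type u} [NormedAddCommGroup 𝓗] [InnerProductSpace ℂ 𝓗]

theorem UnitaryRep.apply_mem_span_orbit (π : UnitaryRep G 𝓗) (K : Subgroup G) (ξ : 𝓗)
    {k : G} (hk : k ∈ K) {u : 𝓗}
    (hu : u ∈ Submodule.span ℂ ((fun k : G => π.toHom k ξ) '' (K : Set G))) :
    π.toHom k u ∈ Submodule.span ℂ ((fun k : G => π.toHom k ξ) '' (K : Set G)) := by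
  induction hu using Submodule.span_induction with
  | mem u h =>
    obtain ⟨l, hl, rfl⟩ := h
    exact Submodule.subset_span ⟨k * l, K.mul_mem hk hl, π.map_mul_apply k l ξ⟩
  | zero => simp
  | add u u' _ _ h h' => rw [map_add]; exact Submodule.add_mem _ h h'
  | smul c u _ h => rw [map_smul]; exact Submodule.smul_mem _ c h

/-- By unitarity the orthogonal complement of a K-stable space is K-stable too. -/
theorem UnitaryRep.starProjection_apply (π : UnitaryRep G 𝓗) {K : Subgroup G}
    {V : Submodule ℂ 𝓗} [FiniteDimensional ℂ V] (hV : ∀ k ∈ K, ∀ u ∈ V, π.toHom k u ∈ V)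
    {k : G} (hk : k ∈ K) (h : 𝓗) :
    V.starProjection (π.toHom k h) = π.toHom k (V.starProjection h) := by
  refine Submodule.eq_starProjection_of_mem_of_inner_eq_zero
    (hV k hk _ (V.starProjection_apply_mem h)) fun u hu => ?_
  rw [← map_sub, ← inner_conj_symm, π.inner_apply_right, inner_conj_symm]
  exact V.starProjection_inner_eq_zero h _ (hV _ (inv_mem hk) u hu)

/-- The operators from `V` to `W`, extended by zero, which commute with `M`. -/
def intertwiners (π : UnitaryRep G 𝓗) (M : Subgroup G) (V W : Submodule ℂ 𝓗)
    [FiniteDimensional ℂ V] [FiniteDimensional ℂ W] : Submodule ℂ (𝓗 →L[ℂ] 𝓗) where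
  carrier := {T | (∀ h, W.starProjection (T (V.starProjection h)) = T h) ∧
    ∀ m ∈ M, ∀ h, T (π.toHom m h) = π.toHom m (T h)}
  add_mem' {T T'} hT hT' := ⟨fun h => by simp [hT.1, hT'.1], fun m hm h => by
    simp [hT.2 m hm, hT'.2 m hm]⟩
  zero_mem' := ⟨by simp, by simp⟩
  smul_mem' c T hT := ⟨fun h => by simp [hT.1], fun m hm h => by simp [hT.2 m hm]⟩

instance (π : UnitaryRep G 𝓗) (M : Subgroup G) (V W : Submodule ℂ 𝓗)
    [FiniteDimensional ℂ V] [FiniteDimensional ℂ W] :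
    FiniteDimensional ℂ (intertwiners π M V W) := by
  let Ψ : (V →L[ℂ] W) →ₗ[ℂ] (𝓗 →L[ℂ] 𝓗) :=
    { toFun := fun S => W.subtypeL.comp (S.comp V.orthogonalProjectionOnto)
      map_add' := fun S S' => by ext; simp
      map_smul' := fun c S => by ext; simp }
  refine Submodule.finiteDimensional_of_le (S₂ := LinearMap.range Ψ) fun T hT => ?_
  refine ⟨W.orthogonalProjectionOnto.comp (T.comp V.subtypeL), ?_⟩
  ext h
  exact hT.1 h

/-- The compression of `π(g)` to an operator from `V` to `W`. -/
def compression (π : UnitaryRep G 𝓗) (V W : Submodule ℂ 𝓗)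
    [FiniteDimensional ℂ V] [FiniteDimensional ℂ W] (g : G) : 𝓗 →L[ℂ] 𝓗 :=
  W.starProjection.comp
    (((π.toHom g).toContinuousLinearEquiv : 𝓗 →L[ℂ] 𝓗).comp V.starProjection)

theorem inner_compression (π : UnitaryRep G 𝓗) (V W : Submodule ℂ 𝓗)
    [FiniteDimensional ℂ V] [FiniteDimensional ℂ W] (g : G) {u w : 𝓗} (hu : u ∈ V) (hw : w ∈ W) :
    inner ℂ w (compression π V W g u) = inner ℂ w (π.toHom g u) := by
  change inner ℂ w (W.starProjection (π.toHom g (V.starProjection u))) = _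
  rw [← Submodule.inner_starProjection_left_eq_right, Submodule.starProjection_eq_self_iff.2 hu,
    Submodule.starProjection_eq_self_iff.2 hw]

theorem compression_mem_intertwiners (π : UnitaryRep G 𝓗) {K M : Subgroup G} (hMK : M ≤ K)
    {V W : Submodule ℂ 𝓗} [FiniteDimensional ℂ V] [FiniteDimensional ℂ W]
    (hV : ∀ k ∈ K, ∀ u ∈ V, π.toHom k u ∈ V) (hW : ∀ k ∈ K, ∀ u ∈ W, π.toHom k u ∈ W)
    {b : G} (hb : ∀ m ∈ M, m * b * m⁻¹ = b) :
    compression π V W b ∈ intertwiners π M V W := by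
  constructor
  · intro h
    change W.starProjection (W.starProjection (π.toHom b (V.starProjection (V.starProjection h))))
      = W.starProjection (π.toHom b (V.starProjection h))
    rw [Submodule.starProjection_eq_self_iff.2 (V.starProjection_apply_mem h),
      Submodule.starProjection_eq_self_iff.2 (W.starProjection_apply_mem _)]
  · intro m hm h
    change W.starProjection (π.toHom b (V.starProjection (π.toHom m h))) =
      π.toHom m (W.starProjection (π.toHom b (V.starProjection h)))
    rw [π.starProjection_apply hV (hMK hm), ← π.starProjection_apply hW (hMK hm),
      ← π.map_mul_apply, ← π.map_mul_apply, ← mul_inv_eq_iff_eq_mul.1 (hb m hm)]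

end Intertwiners

/-! ### From bi-invariant to K-finite coefficients. -/

variable {E : Type v} [NormedAddCommGroup E] [NormedSpace ℝ E] [FiniteDimensional ℝ E]
  {G : Type u} [Group G] [TopologicalSpace G] [T2Space G] [ChartedSpace E G]
  [LieGroup 𝓘(ℝ, E) ∞ G] [IsTopologicalGroup G] [LocallyCompactSpace G]
  [MeasurableSpace G] [BorelSpace G]
  {K : Subgroup G} [CompactSpace K]
  (ν : Measure K) [IsProbabilityMeasure ν] [ν.IsMulLeftInvariant] [ν.IsOpenPosMeasure]
  (μ : Measure G) [μ.IsHaarMeasure] [μ.Regular]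

include ν μ in
theorem isHolderOnManifold_of_mem_kFiniteCoefficients {Gr : Set G} (hGr : IsOpen Gr)
    (hKAK : HasWellBehavedKAK E Gr K) {r : ℕ} {α : ℝ} (hα : α ≤ 1)
    (hbi : ∀ f ∈ biInvariantCoefficients K, IsHolderOnManifold E r α f Gr)
    {φ : G → ℂ} (hφ : φ ∈ kFiniteCoefficients K) : IsHolderOnManifold E r α φ Gr := by
  obtain ⟨A, M, a, -, hMK, ha, hasm, hstab, hloc⟩ := hKAK
  obtain ⟨𝓗, _, _, _, π, ξ, η, hξ, hη, rfl⟩ := hφ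
  set V := Submodule.span ℂ ((fun k : G => π.toHom k ξ) '' (K : Set G))
  set W := Submodule.span ℂ ((fun k : G => π.toHom k η) '' (K : Set G))
  have : FiniteDimensional ℂ V := hξ
  have : FiniteDimensional ℂ W := hη
  have hV : ∀ k ∈ K, ∀ u ∈ V, π.toHom k u ∈ V := fun k hk u hu => π.apply_mem_span_orbit K ξ hk hu
  have hW : ∀ k ∈ K, ∀ u ∈ W, π.toHom k u ∈ W := fun k hk u hu => π.apply_mem_span_orbit K η hk hu
  have hξV : ξ ∈ V := Submodule.subset_span ⟨1, K.one_mem, π.map_one_apply ξ⟩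
  have hηW : η ∈ W := Submodule.subset_span ⟨1, K.one_mem, π.map_one_apply η⟩
  have hFN : ∀ b ∈ A, compression π V W b ∈ intertwiners π M V W := fun b hb =>
    compression_mem_intertwiners π hMK hV hW fun m hm =>
      ((hstab b hb).ge (show (m, m) ∈ _ from ⟨rfl, hm⟩)).2.2
  -- For k in K, v(k) = π(k)ξ by equivariance, so the smooth field v replaces the orbit map of ξ;
  -- likewise w for η.
  obtain ⟨v, hv, hv1⟩ := exists_isEquivariantField_one_eq (E := E) ν hV hξV
  obtain ⟨w, hw, hw1⟩ := exists_isEquivariantField_one_eq (E := E) ν hW hηW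
  refine IsHolderOnManifold.of_locally_sum_mul hα fun x hx => ?_
  -- Smooth families of functionals whose value at the compression of π(b) is, for b in A, a
  -- bi-invariant coefficient at b.
  let 𝒟 : Set (G → intertwiners π M V W →L[ℂ] ℂ) :=
    {d | ContMDiff 𝓘(ℝ, E) 𝓘(ℝ, intertwiners π M V W →L[ℂ] ℂ) ∞ d ∧
      ∃ ψ ∈ biInvariantCoefficients K, ∀ b (hb : b ∈ A),
        ψ b = d b ⟨compression π V W b, hFN b hb⟩}
  have hsep : ∀ T : intertwiners π M V W, T ≠ 0 → ∃ d ∈ 𝒟, d (a x) T ≠ 0 := by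
    rintro ⟨T, hT⟩ hT0
    obtain ⟨u, hu, hTu⟩ : ∃ u ∈ V, T u ≠ 0 := by
      by_contra! h
      refine hT0 (Subtype.ext (ContinuousLinearMap.ext fun z => ?_))
      change T z = 0
      rw [← hT.1, h _ (V.starProjection_apply_mem z), map_zero]
    have hb : ∀ k ∈ K, ∀ l ∈ K, k * a x * l⁻¹ = a x → k = l ∧ k ∈ M := fun k hk l hl h =>
      (hstab _ (ha x hx).1).le (show (k, l) ∈ _ from ⟨hk, hl, h⟩)
    obtain ⟨v', w', hv', hwc, hws, hwK, hwW, hne⟩ :=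
      exists_field_integral_inner_ne_zero (E := E) ν μ hV hW hb
        (fun z => by rw [← hT.1]; exact W.starProjection_apply_mem _) hT.2 hu hTu
    obtain ⟨d, hd, hdT⟩ := exists_contMDiff_functional μ (intertwiners π M V W)
      hv'.contMDiff hwc hws
    refine ⟨d, ⟨hd, _, integral_inner_mem_biInvariantCoefficients μ π K
      hv'.contMDiff.continuous hv'.hasCompactSupport hv'.equivariant hwc hws hwK,
      fun b hb => ?_⟩, by rwa [hdT]⟩
    rw [hdT]
    refine integral_congr_ae (.of_forall fun y => ?_)
    exact (inner_compression π V W b (hv'.mem _) (hwW y)).symm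
  obtain ⟨n, d, D, hd, hD, hrec⟩ := exists_contMDiffAt_reconstruction (E := E) (𝒟 := 𝒟) (x := a x)
    (fun d hd => hd.1.contMDiffAt) hsep
  choose ψ hψ hψd using fun i => (hd i).2
  obtain ⟨O, hO, hxO, hOG, k₁, k₂, hk₁, hk₂, hk⟩ := hloc x hx
  have hax : ContMDiffAt 𝓘(ℝ, E) 𝓘(ℝ, E) ∞ a x := hasm.contMDiffAt (hGr.mem_nhds hx)
  refine ⟨n, ψ, fun i g => inner ℂ (w (k₁ g)⁻¹)
    ((D i (a g) : 𝓗 →L[ℂ] 𝓗) (v (k₂ g)⁻¹)), fun i => hbi _ (hψ i), fun i => ?_, ?_⟩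
  · have h1 : ContMDiffAt 𝓘(ℝ, E) 𝓘(ℝ, 𝓗) ∞ (fun g => v (k₂ g)⁻¹) x :=
      ContMDiffAt.comp x hv.contMDiff.contMDiffAt (hk₂.contMDiffAt (hO.mem_nhds hxO)).inv
    have h2 : ContMDiffAt 𝓘(ℝ, E) 𝓘(ℝ, 𝓗) ∞ (fun g => w (k₁ g)⁻¹) x :=
      ContMDiffAt.comp x hw.contMDiff.contMDiffAt (hk₁.contMDiffAt (hO.mem_nhds hxO)).inv
    let B : intertwiners π M V W →L[ℝ] (𝓗 →L[ℝ] 𝓗) :=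
      (ContinuousLinearMap.restrictScalarsL ℂ 𝓗 𝓗 ℝ ℝ).comp
        ((intertwiners π M V W).subtypeL.restrictScalars ℝ)
    have h3 : ContMDiffAt 𝓘(ℝ, E) 𝓘(ℝ, 𝓗 →L[ℝ] 𝓗) ∞ (fun g => B (D i (a g))) x :=
      ContMDiffAt.comp x B.contMDiff.contMDiffAt (ContMDiffAt.comp x (hD i) hax)
    have h4 : ContMDiffAt 𝓘(ℝ, E) 𝓘(ℝ, 𝓗) ∞ (fun g => B (D i (a g)) (v (k₂ g)⁻¹)) x :=
      h3.clm_apply h1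
    have h5 : ContDiff ℝ ∞ (fun p : 𝓗 × 𝓗 => inner ℂ p.1 p.2) := contDiff_inner
    exact ContMDiffAt.comp x h5.contMDiff.contMDiffAt (h2.prodMk_space h4)
  · filter_upwards [hax.continuousAt.eventually hrec, hO.mem_nhds hxO] with g hg hgO
    obtain ⟨hk₁g, hk₂g, hgk⟩ := hk g hgO
    have haA : a g ∈ A := (ha g (hOG hgO)).1
    have hvg : v (k₂ g)⁻¹ = π.toHom (k₂ g)⁻¹ ξ := by
      rw [← hv1, ← hv.equivariant _ (inv_mem hk₂g), mul_one]
    have hwg : w (k₁ g)⁻¹ = π.toHom (k₁ g)⁻¹ η := by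
      rw [← hw1, ← hw.equivariant _ (inv_mem hk₁g), mul_one]
    calc π.coeff ξ η g = inner ℂ η (π.toHom (k₁ g * (a g * (k₂ g)⁻¹)) ξ) := by
          rw [UnitaryRep.coeff, ← mul_assoc, ← hgk]
      _ = inner ℂ (w (k₁ g)⁻¹) (compression π V W (a g) (v (k₂ g)⁻¹)) := by
          rw [inner_compression π V W _ (hv.mem _) (hw.mem _), hvg, hwg, π.map_mul_apply,
            π.inner_apply_right, π.map_mul_apply]
      _ = ∑ i, ψ i g * inner ℂ (w (k₁ g)⁻¹) ((D i (a g) : 𝓗 →L[ℂ] 𝓗) (v (k₂ g)⁻¹)) := by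
          have h6 := congrArg (Subtype.val) (hg ⟨_, hFN _ haA⟩)
          dsimp only at h6
          rw [h6, Submodule.coe_sum, sum_apply, inner_sum]
          refine Finset.sum_congr rfl fun i _ => ?_
          rw [← hψd i _ haA, Submodule.coe_smul, smul_apply, inner_smul_right]
          congr 1
          conv_rhs => rw [hgk]
          -- Bi-invariance turns ψ i (a g) into ψ i g, so the factor of limited regularity is a
          -- function on `Gr` covered by the hypothesis.
          exact ((hψ i).2 _ hk₁g _ (inv_mem hk₂g) _).symm

end KAKRegularity

end

theorem mainTheorem4
    {E : Type*} [NormedAddCommGroup E] [NormedSpace ℝ E] [FiniteDimensional ℝ E]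
    {G : Type*} [Group G] [TopologicalSpace G] [T2Space G] [ChartedSpace E G]
    [LieGroup 𝓘(ℝ, E) ∞ G]
    (K : Subgroup G) (hK : IsCompact (K : Set G))
    (Gr : Set G) (hGr : IsOpen Gr)
    (hinv : ∀ k₁ ∈ K, ∀ k₂ ∈ K, ∀ g ∈ Gr, k₁ * g * k₂ ∈ Gr)
    (hKAK : KAKRegularity.HasWellBehavedKAK E Gr K) :
    KAKRegularity.regularityExponents E (KAKRegularity.biInvariantCoefficients K) Gr =
        KAKRegularity.regularityExponents E (KAKRegularity.kFiniteCoefficients K) Gr ∧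
      KAKRegularity.optimalRegularity E (KAKRegularity.biInvariantCoefficients K) Gr =
        KAKRegularity.optimalRegularity E (KAKRegularity.kFiniteCoefficients K) Gr := by
  have : IsTopologicalGroup G := topologicalGroup_of_lieGroup 𝓘(ℝ, E) ∞
  have : LocallyCompactSpace G := Manifold.locallyCompact_of_finiteDimensional 𝓘(ℝ, E)
  have : CompactSpace K := isCompact_iff_compactSpace.1 hK
  borelize G
  -- Normalizing Haar measure on the whole compact group gives total mass one.
  let ν : MeasureTheory.Measure K := MeasureTheory.Measure.haarMeasure ⊤
  have : MeasureTheory.IsProbabilityMeasure ν :=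
    ⟨by simpa using MeasureTheory.Measure.haarMeasure_self (K₀ := (⊤ :
      TopologicalSpace.PositiveCompacts K))⟩
  have h : KAKRegularity.regularityExponents E (KAKRegularity.biInvariantCoefficients K) Gr =
      KAKRegularity.regularityExponents E (KAKRegularity.kFiniteCoefficients K) Gr := by
    refine Set.Subset.antisymm ?_ ?_
    · rintro ⟨r, δ⟩ ⟨h0, h1, h2⟩
      exact ⟨h0, h1, fun φ hφ => KAKRegularity.isHolderOnManifold_of_mem_kFiniteCoefficients ν
        MeasureTheory.Measure.haar hGr hKAK h1 h2 hφ⟩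
    · rintro ⟨r, δ⟩ ⟨h0, h1, h2⟩
      exact ⟨h0, h1, fun φ hφ => h2 φ
        (KAKRegularity.biInvariantCoefficients_subset_kFiniteCoefficients ν hφ)⟩
  exact ⟨h, by rw [KAKRegularity.optimalRegularity, h, KAKRegularity.optimalRegularity]⟩
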